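/- **Setting.** Let $(\mathbf X,Y)$ be a random vector with $\mathbf X=(X_1,\dots,X_p)\in\mathbb R^p$ and $Y\in\mathbb R$ a continuous random variable (its distribution function is continuous); nothing else is assumed on the law. Let $(\mathbf X^1,Y^1),\dots,(\mathbf X^n,Y^n)$ be an i.i.d. sample. Let $D\subset S\subset\{1,\dots,p\}$, where $D$ is the set of important variables (in the application, those $j$ for which the conditional distribution function of $Y$ given $\mathbf X$ functionally depends on $X_j$; only $D\subset S$ is used, so $D$ may be any subset of $S$). Let $N\ge1$ and let $G_1,\dots,G_N\ge 1$ be integers, $G_{\min}=\min_iG_i$. For an integer $G\ge1$ and a distribution function $F$ put $a_0=-\infty$, $a_G=+\infty$ and $a_l=\inf\{y:F(y)\ge l/G\}$ for $0<l<G$; the intervals $[a_l,a_{l+1})$, $0\le l<G$ (open at $-\infty$), are the $G$ slices of $F$. The *oracle slices* are those of the true distribution function of $Y$, the *sample slices* those of the empirical distribution function of $Y^1,\dots,Y^n$. For the oracle slices $I_0,\dots,I_{G-1}$ let $F_j(x\mid l)=\Pr(X_j\le x\mid Y\in I_l)$ and $$K_j^{(o)}(G)=\max_{l,m}\sup_{x\in\mathbb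 R}|F_j(x\mid l)-F_j(x\mid m)|.$$ For any slicing let $\hat F_j(x\mid l)$ be the proportion of observations with $X_j^i\le x$ among those with $Y^i$ in slice $l$, and $\hat K_j(G)=\max_{l,m}\sup_x|\hat F_j(x\mid l)-\hat F_j(x\mid m)|$. The fused statistic is $\sum_{i=1}^N\hat K_j(G_i)$; it is the statistic of the *oracle fused Kolmogorov filter* if the oracle slices are used, and of the *fused Kolmogorov filter* if the sample slices are used. The screening sets $\hat D(\mathrm{oracle})$ and $\hat D$ consist of the $\min(d_n,p)$ indices $j$ with the largest values of the respective statistic (ties broken in any way). **Conditions.** (C1) $\displaystyle\Delta_S=\min_i\Bigl(\min_{j\in S}K_j^{(o)}(G_i)-\max_{j\notin S}K_j^{(o)}(G_i)\Bigr)>0$ (an extremum over the empty set is read as $0$). (C2) For some version $F_j(x\mid y)$ of the regular conditional distribution function of $X_j$ given $Y=y$: for all $b_1,b_2$ with $\Pr(Y\in[b_1,b_2))\le 2/G_{\min}$, $|F_j(x\mid y_1)-F_j(x\mid y_2)|\le\Delta_S/8$ for all $x$, all $j$ and all $y_1,y_2\in[b_1,b_2)$. **Theorem.** There are universal constants $C,c>0$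 such that the following holds. Assume (C1), (C2), $G_i\le\lceil\log n\rceil$ for all $i$, and $d_n\ge|S|$. Put $$\eta=CNp(\log^2n)\exp\Bigl(-c\frac{n\Delta_S^2}{\log n}\Bigr)+CN(\log^2n)\exp\Bigl(-c\frac{n}{\log^2n}\Bigr).$$ Then (1) $\Pr(D\subset\hat D(\mathrm{oracle}))\ge1-\eta$, and (2) $\Pr(D\subset\hat D)\ge1-\eta$. Moreover, consider a sequence of such problems indexed by the sample size $n$, in which the law of $(\mathbf X,Y)$ and $p,N,G_i,D,S,d_n$ may all depend on $n$, and the assumptions above hold for all sufficiently large $n$. If $\Delta_S\gg\sqrt{\log n\cdot\log(pN\log n)/n}$, that is, if the ratio of the two sides tends to $\infty$, then $\Pr(D\subset\hat D(\mathrm{oracle}))\to1$ and $\Pr(D\subset\hat D)\to1$. -/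

import Mathlib

open MeasureTheory ProbabilityTheory Filter

noncomputable section

namespace FusedKolmogorov

/-! ### Slicing the response -/

/-- The `τ`-quantile `inf {y | τ ≤ F y}` of a distribution function `F`
(used for levels `0 < τ < 1`). -/
def quantile (F : ℝ → ℝ) (τ : ℝ) : ℝ := sInf {y : ℝ | τ ≤ F y}

/-- Cut points of the uniform slicing into `G` slices: `a_0 = -∞`, `a_G = +∞`, and `a_l` is the
`l / G`-quantile of `F` for `0 < l < G`. -/
def cut (F : ℝ → ℝ) (G l : ℕ) : EReal :=
  if l = 0 then ⊥ else if l < G then ((quantile F ((l : ℝ) / (G : ℝ)) : ℝ) : EReal) else ⊤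

/-- The slice `[a_l, a_{l+1})`, for `l = 0, …, G - 1`. -/
def slice (F : ℝ → ℝ) (G : ℕ) (l : Fin G) : Set ℝ :=
  {y : ℝ | cut F G (l : ℕ) ≤ (y : EReal) ∧ (y : EReal) < cut F G ((l : ℕ) + 1)}

/-- `max_{l,m} sup_x |φ_l(x) - φ_m(x)|` for a finite family of distribution functions. -/
def maxKS {G : ℕ} (φ : Fin G → ℝ → ℝ) : ℝ :=
  ⨆ l : Fin G, ⨆ m : Fin G, ⨆ x : ℝ, |φ l x - φ m x|

/-! ### Population quantities; `P` is the joint law of `(X, Y)`, with `X ∈ ℝ^p`, `Y ∈ ℝ` -/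

/-- Distribution function of `Y`. -/
def cdfY {p : ℕ} (P : Measure ((Fin p → ℝ) × ℝ)) (y : ℝ) : ℝ :=
  P.real {w | w.2 ≤ y}

/-- `F_j(x | H = l) = Pr(X_j ≤ x | Y in slice l)`, slices at the true quantiles of `Y`. -/
def sliceCDF {p : ℕ} (P : Measure ((Fin p → ℝ) × ℝ)) (G : ℕ) (j : Fin p) (l : Fin G) (x : ℝ) : ℝ :=
  (cond P {w | w.2 ∈ slice (cdfY P) G l}).real {w | w.1 j ≤ x}

/-- The oracle population statistic `K_j^{(o)}(G)`. -/
def oracleK {p : ℕ} (P : Measure ((Fin p → ℝ) × ℝ)) (G : ℕ) (j : Fin p) : ℝ :=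
  maxKS (sliceCDF P G j)

/-! ### Sample quantities; `z` is a sample of size `n` -/

open Classical in
/-- Empirical distribution function of `Y`. -/
def empCDFY {n p : ℕ} (z : Fin n → (Fin p → ℝ) × ℝ) (y : ℝ) : ℝ :=
  ((Finset.univ.filter fun i => (z i).2 ≤ y).card : ℝ) / (n : ℝ)

open Classical in
/-- Empirical distribution function of `X_j` among the observations whose response lies in `A`. -/
def empCDF {n p : ℕ} (z : Fin n → (Fin p → ℝ) × ℝ) (A : Set ℝ) (j : Fin p) (x : ℝ) : ℝ :=
  ((Finset.univ.filter fun i => (z i).2 ∈ A ∧ (z i).1 j ≤ x).card : ℝ) /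
    ((Finset.univ.filter fun i => (z i).2 ∈ A).card : ℝ)

/-- Fused statistic `∑_i K̂_j^{G_i}`, where slice `l` of the `i`-th slicing is
`slice F (G i) l`. -/
def fusedStat {n p N : ℕ} (F : ℝ → ℝ) (G : Fin N → ℕ) (z : Fin n → (Fin p → ℝ) × ℝ)
    (j : Fin p) : ℝ :=
  ∑ i : Fin N, maxKS fun (l : Fin (G i)) (x : ℝ) => empCDF z (slice F (G i) l) j x

/-- Statistic of the oracle fused Kolmogorov filter (slices at the true quantiles of `Y`). -/
def oracleStat {n p N : ℕ} (P : Measure ((Fin p → ℝ) × ℝ)) (G : Fin N → ℕ)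
    (z : Fin n → (Fin p → ℝ) × ℝ) (j : Fin p) : ℝ :=
  fusedStat (cdfY P) G z j

/-- Statistic of the fused Kolmogorov filter (slices at the sample quantiles of `Y`). -/
def filterStat {n p N : ℕ} (G : Fin N → ℕ) (z : Fin n → (Fin p → ℝ) × ℝ) (j : Fin p) : ℝ :=
  fusedStat (empCDFY z) G z j

/-- `T` consists of the `d` indices with the largest values of `v` (all indices if `d ≥ p`),
ties being broken in some way. -/
def IsTop {p : ℕ} (d : ℕ) (v : Fin p → ℝ) (T : Finset (Fin p)) : Prop :=
  T.card = min d p ∧ ∀ j ∈ T, ∀ k ∉ T, v k ≤ v j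

/-- A screening problem: `p` covariates with joint law `P` of `(X, Y)`, numbers of slices
`G_1, …, G_N`, a set `D` of important covariates, a set `S`, and the size `d` of the screening
set. -/
structure Problem where
  p : ℕ
  N : ℕ
  P : Measure ((Fin p → ℝ) × ℝ)
  isProb : IsProbabilityMeasure P
  G : Fin N → ℕ
  D : Finset (Fin p)
  S : Finset (Fin p)
  d : ℕ

namespace Problem

variable (M : Problem)

/-- `Δ_S = min_i (min_{j ∈ S} K_j^{(o)}(G_i) - max_{j ∉ S} K_j^{(o)}(G_i))`. All the extrema are
over finite sets; an extremum of the nonnegative numbers `K_j^{(o)}(G_i)` over the empty set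
is read as `0`. -/
def gap : ℝ :=
  ⨅ i : Fin M.N, ((⨅ j : {j : Fin M.p // j ∈ M.S}, oracleK M.P (M.G i) j) -
    ⨆ j : {j : Fin M.p // j ∉ M.S}, oracleK M.P (M.G i) j)

/-- `G_min = min_i G_i`. -/
def Gmin : ℕ := ⨅ i : Fin M.N, M.G i

/-- Condition (C1). -/
def C1 : Prop := M.D ⊆ M.S ∧ 0 < M.gap

/-- Condition (C2). The conditional distribution `F_j(· | y)` is a regular conditional
distribution of `X_j` given `Y`, that is, a Markov kernel `κ` with
`Law(Y, X_j) = Law(Y) ⊗ κ`; the condition is required of some version of it. -/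
def C2 : Prop :=
  ∀ j : Fin M.p, ∃ κ : Kernel ℝ ℝ, IsMarkovKernel κ ∧
    M.P.map (fun w => (w.2, w.1 j)) = (M.P.map fun w => w.2) ⊗ₘ κ ∧
    ∀ b₁ b₂ : ℝ, M.P.real {w | w.2 ∈ Set.Ico b₁ b₂} ≤ 2 / (M.Gmin : ℝ) →
      ∀ x : ℝ, ∀ y₁ ∈ Set.Ico b₁ b₂, ∀ y₂ ∈ Set.Ico b₁ b₂,
        |(κ y₁).real (Set.Iic x) - (κ y₂).real (Set.Iic x)| ≤ M.gap / 8

/-- The assumptions for sample size `n`: `Y` is a continuous random variable, there is at least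
one slicing and each slicing has at least one and at most `⌈log n⌉` slices, conditions
(C1) and (C2) hold, and `d ≥ |S|`. -/
structure Assumptions (n : ℕ) : Prop where
  continuous_Y : ∀ y : ℝ, M.P {w | w.2 = y} = 0
  N_pos : 1 ≤ M.N
  G_pos : ∀ i, 1 ≤ M.G i
  G_le : ∀ i, M.G i ≤ ⌈Real.log n⌉₊
  c1 : M.C1
  c2 : M.C2
  S_card_le : M.S.card ≤ M.d

/-- `Pr(D ⊆ D̂(oracle))` for an i.i.d. sample of size `n` from `P`, however ties in the ranking
are broken. -/
def probOracle (n : ℕ) : ℝ :=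
  (Measure.pi fun _ : Fin n => M.P).real
    {z | ∀ T : Finset (Fin M.p), IsTop M.d (oracleStat M.P M.G z) T → M.D ⊆ T}

/-- `Pr(D ⊆ D̂)` for an i.i.d. sample of size `n` from `P`, however ties in the ranking
are broken. -/
def probFilter (n : ℕ) : ℝ :=
  (Measure.pi fun _ : Fin n => M.P).real
    {z | ∀ T : Finset (Fin M.p), IsTop M.d (filterStat M.G z) T → M.D ⊆ T}

/-- The error bound `η`, with constant `C` in front of and `c` inside the exponentials. -/
def eta (C c : ℝ) (n : ℕ) : ℝ :=
  C * M.N * M.p * Real.log n ^ 2 * Real.exp (-(c * (n * M.gap ^ 2 / Real.log n))) +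
    C * M.N * Real.log n ^ 2 * Real.exp (-(c * (n / Real.log n ^ 2)))

end Problem

end FusedKolmogorov

end

/-!
The argument compares the sample statistic with the population statistic `K_j^{(o)}(G_i)`. If every
slice distribution function is estimated within `3 Δ_S / 16`, each `K̂_j(G_i)` is within
`3 Δ_S / 8 < Δ_S / 2` of its population value, so every index of `S` is ranked above every index
outside `S`, and the `min(d, p) ≥ |S|` top indices contain `S ⊇ D`
(`Problem.Assumptions.subset_of_isTop`).

The estimation error has two parts, separated by conditioning on the responses. Given these, the
values of `X_j` are independent with laws `κ (Y^k)`, where `κ` is the kernel of condition (C2), and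
the slices, oracle or sample, are fixed sets of indices.

* Bias. On the event that the empirical distribution function of `Y` is within `1 / (8 L)` of the
  true one, where `L = 2 log n ≥ G_i`, the sample slices lie close to the oracle slices: each
  contains at least `n / (2 G_i)` observations (`le_card_indexSet_slice`), and a response in one and
  a point in the other differ by less than `2 / G_min` in probability, so that (C2) bounds the
  difference of the conditional distribution functions by `Δ_S / 8`
  (`Problem.Assumptions.abs_sliceCDF_sub_le`). This event is the same for all slicings and all
  covariates, and fails with probability of order `exp(-c n / log² n)`.
* Noise. The empirical process of independent, not identically distributed variables satisfies a
  Dvoretzky–Kiefer–Wolfowitz inequality whose prefactor does not grow with the sample size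
  (`measure_exists_lt_abs_deviation_le`). A polynomial prefactor would not be absorbed by
  `log² n`. The proof symmetrizes with an independent copy; with random signs, the supremum of the
  process is the maximum of a simple random walk that visits the points in increasing order, and
  an induction over the points gives the exponential maximal inequality
  (`card_exists_le_signedSum_le`). A union bound over the slices of all slicings and all covariates
  gives the term `N p log² n exp(-c n Δ_S² / log n)`.

Both filters are covered at once by `Problem.Assumptions.one_sub_le_real`, which allows slices of
any distribution function `F` that depends measurably on the responses and is close to the true one
whenever the empirical one is.

For the limit statement the second term of `η` is not enough: its factor `N` is not controlled at
that rate. The bound `Problem.sharpEta` proved here has no `N` in the second term, and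
tends to `0` whenever the gap dominates the critical rate.
-/

noncomputable section

namespace FusedKolmogorov

/-! ### Random signs and exchanged pairs -/

open Classical in
/-- Elementary optional stopping for a signed walk: the points `x i`, `i ∈ A`, are visited in
increasing order, with a step `c` at the points of `T` and `-c` at the others. -/
theorem card_exists_le_signedSum_le {ι : Type*} (x : ι → ℝ) (A : Finset ι) {c : ℝ}
    (hc : c = 1 ∨ c = -1) {r : ℝ} (hr : 0 ≤ r) (a : ℝ) :
    ((A.powerset.filter fun T => ∃ q : ℝ,
        a ≤ ∑ i ∈ A, (if i ∈ T then c else -c) * (if x i ≤ q then 1 else 0)).card : ℝ) ≤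
      2 ^ A.card * (Real.exp (-(r * a)) * Real.cosh r ^ A.card) := by
  rw [Finset.card_filter, Nat.cast_sum]
  induction A using Finset.induction_on_min_value x generalizing a with
  | empty =>
    simp only [Finset.powerset_empty, Finset.sum_singleton, Finset.sum_empty, Finset.card_empty,
      pow_zero, mul_one, one_mul, exists_const]
    split_ifs with h
    · have : r * a ≤ 0 := mul_nonpos_of_nonneg_of_nonpos hr h
      simpa using this
    · simpa using (Real.exp_pos _).le
  | insert b s hb hmin ih =>
    rcases le_or_gt a 0 with ha | ha
    · have h1 : ∑ T ∈ (insert b s).powerset, (((if ∃ q : ℝ, a ≤ ∑ i ∈ insert b s,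
          (if i ∈ T then c else -c) * (if x i ≤ q then 1 else 0) then 1 else 0 : ℕ)) : ℝ) ≤
          ∑ T ∈ (insert b s).powerset, (1 : ℝ) :=
        Finset.sum_le_sum fun T _ => by split_ifs <;> simp
      refine h1.trans ?_
      rw [Finset.sum_const, Finset.card_powerset, nsmul_eq_mul, mul_one]
      push_cast
      refine le_mul_of_one_le_right (by positivity) ?_
      refine one_le_mul_of_one_le_of_one_le ?_ (one_le_pow₀ (Real.one_le_cosh r))
      rw [← Real.exp_zero]
      exact Real.exp_le_exp.2 (by nlinarith)
    · have key : ∀ (T : Finset ι) (e : ℝ), (if b ∈ T then c else -c) = e →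
          (((if ∃ q : ℝ, a ≤ ∑ i ∈ insert b s,
          (if i ∈ T then c else -c) * (if x i ≤ q then 1 else 0) then 1 else 0 : ℕ)) : ℝ) ≤
          (((if ∃ q : ℝ, a - e ≤ ∑ i ∈ s,
          (if i ∈ T then c else -c) * (if x i ≤ q then 1 else 0) then 1 else 0 : ℕ)) : ℝ) := by
        intro T e he
        by_cases h : ∃ q : ℝ, a ≤ ∑ i ∈ insert b s,
          (if i ∈ T then c else -c) * (if x i ≤ q then 1 else 0)
        · have h' : ∃ q : ℝ, a - e ≤ ∑ i ∈ s,
              (if i ∈ T then c else -c) * (if x i ≤ q then 1 else 0) := by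
            obtain ⟨q, hq⟩ := h
            refine ⟨q, ?_⟩
            rw [Finset.sum_insert hb, he] at hq
            -- A positive value is reached only after the first point has been visited.
            have hbq : x b ≤ q := by
              by_contra hlt
              rw [if_neg hlt, Finset.sum_eq_zero fun i hi => by
                rw [if_neg fun hiq => hlt ((hmin i hi).trans hiq), mul_zero]] at hq
              linarith
            rw [if_pos hbq] at hq
            linarith
          rw [if_pos h, if_pos h']
        · simp only [if_neg h, Nat.cast_zero]
          split_ifs <;> simp
      rw [Finset.sum_powerset_insert hb]
      have h1 : ∀ T ∈ s.powerset, b ∉ T := fun T hT hbT => hb (Finset.mem_powerset.1 hT hbT)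
      have h2 := (Finset.sum_le_sum fun T hT => key T (-c) (if_neg (h1 T hT))).trans (ih (a - -c))
      have h3 : ∑ T ∈ s.powerset, (((if ∃ q : ℝ, a ≤ ∑ i ∈ insert b s,
          (if i ∈ insert b T then c else -c) * (if x i ≤ q then 1 else 0) then 1 else 0 : ℕ)) : ℝ)
          ≤ 2 ^ s.card * (Real.exp (-(r * (a - c))) * Real.cosh r ^ s.card) := by
        refine (Finset.sum_le_sum fun T hT => key (insert b T) c
          (if_pos (Finset.mem_insert_self b T))).trans (le_trans (le_of_eq ?_) (ih (a - c)))
        refine Finset.sum_congr rfl fun T _ => ?_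
        have : ∀ q : ℝ, ∑ i ∈ s, (if i ∈ insert b T then c else -c) *
            (if x i ≤ q then (1 : ℝ) else 0) =
            ∑ i ∈ s, (if i ∈ T then c else -c) * (if x i ≤ q then 1 else 0) := fun q =>
          Finset.sum_congr rfl fun i hi => by
            have : i ≠ b := fun h => hb (h ▸ hi)
            simp [this]
        simp only [this]
      refine (add_le_add h2 h3).trans (le_of_eq ?_)
      rw [Finset.card_insert_of_notMem hb, pow_succ, pow_succ]
      have h4 : Real.exp (-(r * (a - -c))) + Real.exp (-(r * (a - c))) =
          2 * Real.exp (-(r * a)) * Real.cosh r := by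
        rw [Real.cosh_eq]
        have e1 : Real.exp (-(r * (a + 1))) = Real.exp (-(r * a)) * Real.exp (-r) := by
          rw [← Real.exp_add]; ring_nf
        have e2 : Real.exp (-(r * (a - 1))) = Real.exp (-(r * a)) * Real.exp r := by
          rw [← Real.exp_add]; ring_nf
        rcases hc with rfl | rfl
        · rw [sub_neg_eq_add, e1, e2]; ring
        · rw [neg_neg, sub_neg_eq_add, e1, e2]; ring
      linear_combination (2 ^ s.card * Real.cosh r ^ s.card) * h4

/-- The centred empirical process of the points `x i`, `i ∈ A`, with laws `μ i`. -/
def deviation {ι : Type*} (A : Finset ι) (x : ι → ℝ) (μ : ι → Measure ℝ) (q : ℝ) : ℝ :=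
  ∑ i ∈ A, ((if x i ≤ q then 1 else 0) - (μ i).real (Set.Iic q))

/-- Difference of the counting processes of a sample of pairs. -/
def pairDiff {ι : Type*} (A : Finset ι) (f : ι → ℝ × ℝ) (q : ℝ) : ℝ :=
  ∑ i ∈ A, ((if (f i).1 ≤ q then 1 else 0) - (if (f i).2 ≤ q then 1 else 0))

open Classical in
/-- Exchange of the two entries of the pairs with index in `T`. -/
def swapOn {ι : Type*} (T : Finset ι) (f : ι → ℝ × ℝ) (i : ι) : ℝ × ℝ :=
  if i ∈ T then (f i).swap else f i

theorem measurePreserving_swapOn {ι : Type*} [Fintype ι] (μ : ι → Measure ℝ)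
    [∀ i, IsProbabilityMeasure (μ i)] (T : Finset ι) :
    MeasurePreserving (swapOn T) (Measure.pi fun i => (μ i).prod (μ i))
      (Measure.pi fun i => (μ i).prod (μ i)) := by
  classical
  have h := measurePreserving_pi (fun i => (μ i).prod (μ i)) (fun i => (μ i).prod (μ i))
    (f := fun i => if i ∈ T then Prod.swap else id) (fun i => by
      split_ifs
      · exact Measure.measurePreserving_swap
      · exact MeasurePreserving.id _)
  convert h using 1
  funext f i
  unfold swapOn
  split_ifs <;> rfl

open Classical in
theorem pairDiff_swapOn {ι : Type*} (A T : Finset ι) (f : ι → ℝ × ℝ) (q : ℝ) :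
    pairDiff A (swapOn T f) q =
      ∑ i ∈ A, (if i ∈ T then -1 else - -1) * (if (f i).1 ≤ q then 1 else 0) +
      ∑ i ∈ A, (if i ∈ T then 1 else -1) * (if (f i).2 ≤ q then 1 else 0) := by
  rw [pairDiff, ← Finset.sum_add_distrib]
  refine Finset.sum_congr rfl fun i _ => ?_
  unfold swapOn
  by_cases h : i ∈ T
  · simp only [if_pos h, Prod.fst_swap, Prod.snd_swap]; ring
  · simp only [if_neg h]; ring

open Classical in
/-- The two coordinates of the pairs and the two directions give the factor `4`. -/
theorem card_exists_lt_abs_pairDiff_swapOn_le {ι : Type*} (A : Finset ι) (f : ι → ℝ × ℝ) (s : ℝ)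
    {r : ℝ} (hr : 0 ≤ r) :
    ((A.powerset.filter fun T => ∃ q : ℚ, s < |pairDiff A (swapOn T f) q|).card : ℝ) ≤
      2 ^ A.card * (4 * (Real.exp (-(r * (s / 2))) * Real.cosh r ^ A.card)) := by
  let W (g : ι → ℝ) (c : ℝ) : Finset (Finset ι) := A.powerset.filter fun T => ∃ q : ℝ,
    s / 2 ≤ ∑ i ∈ A, (if i ∈ T then c else -c) * (if g i ≤ q then 1 else 0)
  have hW : ∀ (g : ι → ℝ) (c : ℝ), c = 1 ∨ c = -1 → ((W g c).card : ℝ) ≤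
      2 ^ A.card * (Real.exp (-(r * (s / 2))) * Real.cosh r ^ A.card) := fun g c hc =>
    card_exists_le_signedSum_le g A hc hr (s / 2)
  have hneg : ∀ (T : Finset ι) (g : ι → ℝ) (q c : ℝ),
      ∑ i ∈ A, (if i ∈ T then -c else - -c) * (if g i ≤ q then (1 : ℝ) else 0) =
      - ∑ i ∈ A, (if i ∈ T then c else -c) * (if g i ≤ q then (1 : ℝ) else 0) := by
    intro T g q c
    rw [← Finset.sum_neg_distrib]
    refine Finset.sum_congr rfl fun i _ => ?_
    split_ifs <;> ring
  have hsub : (A.powerset.filter fun T => ∃ q : ℚ, s < |pairDiff A (swapOn T f) q|) ⊆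
      (W (fun i => (f i).1) 1 ∪ W (fun i => (f i).1) (-1)) ∪
      (W (fun i => (f i).2) 1 ∪ W (fun i => (f i).2) (-1)) := by
    intro T hT
    obtain ⟨hTA, q, hq⟩ := Finset.mem_filter.1 hT
    simp only [W, Finset.mem_union, Finset.mem_filter, hTA, true_and]
    rw [pairDiff_swapOn, hneg T (fun i => (f i).1) q 1] at hq
    by_contra! hcon
    obtain ⟨⟨h1, h2⟩, h3, h4⟩ := hcon
    have h1 := h1 q
    have h2 := h2 q
    have h3 := h3 q
    have h4 := h4 q
    rw [hneg] at h2 h4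
    refine absurd hq (not_lt.2 (abs_le.2 ⟨?_, ?_⟩)) <;> linarith
  have h1 := (Finset.card_le_card hsub).trans ((Finset.card_union_le _ _).trans
    (add_le_add (Finset.card_union_le _ _) (Finset.card_union_le _ _)))
  have h2 : ((A.powerset.filter fun T => ∃ q : ℚ, s < |pairDiff A (swapOn T f) q|).card : ℝ) ≤ _ :=
    Nat.cast_le.2 h1
  push_cast at h2
  have := hW (fun i => (f i).1) 1 (by simp)
  have := hW (fun i => (f i).1) (-1) (by simp)
  have := hW (fun i => (f i).2) 1 (by simp)
  have := hW (fun i => (f i).2) (-1) (by simp)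
  linarith

theorem measurable_pairDiff {ι : Type*} (A : Finset ι) (q : ℝ) :
    Measurable fun f : ι → ℝ × ℝ => pairDiff A f q := by
  unfold pairDiff
  refine Finset.measurable_sum _ fun i _ => Measurable.sub ?_ ?_
  · exact Measurable.ite (measurableSet_le (by fun_prop) measurable_const) (by fun_prop)
      (by fun_prop)
  · exact Measurable.ite (measurableSet_le (by fun_prop) measurable_const) (by fun_prop)
      (by fun_prop)

theorem measurableSet_exists_lt_abs_pairDiff {ι : Type*} (A : Finset ι) (s : ℝ) :
    MeasurableSet {f : ι → ℝ × ℝ | ∃ q : ℚ, s < |pairDiff A f q|} := by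
  rw [Set.ofPred_exists]
  exact MeasurableSet.iUnion fun q =>
    measurableSet_lt measurable_const (measurable_pairDiff A q).abs

/-- Exchanging pairs at random reduces the two-sample process to a walk with random signs. -/
theorem measure_exists_lt_abs_pairDiff_le {ι : Type*} [Fintype ι] (μ : ι → Measure ℝ)
    [∀ i, IsProbabilityMeasure (μ i)] (A : Finset ι) (s : ℝ) {r : ℝ} (hr : 0 ≤ r) :
    (Measure.pi fun i => (μ i).prod (μ i)) {f | ∃ q : ℚ, s < |pairDiff A f q|} ≤
      ENNReal.ofReal (4 * (Real.exp (-(r * (s / 2))) * Real.cosh r ^ A.card)) := by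
  classical
  set ρ := Measure.pi fun i => (μ i).prod (μ i)
  set E := {f : ι → ℝ × ℝ | ∃ q : ℚ, s < |pairDiff A f q|} with hE
  have hEm : MeasurableSet E := measurableSet_exists_lt_abs_pairDiff A s
  set B := 4 * (Real.exp (-(r * (s / 2))) * Real.cosh r ^ A.card) with hB
  have hB0 : 0 ≤ B := by have := Real.cosh_pos r; positivity
  have h1 : (2 : ENNReal) ^ A.card * ρ E = ∑ T ∈ A.powerset, ρ (swapOn T ⁻¹' E) := by
    rw [Finset.sum_congr rfl fun T _ =>
      (measurePreserving_swapOn μ T).measure_preimage hEm.nullMeasurableSet]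
    rw [Finset.sum_const, Finset.card_powerset, nsmul_eq_mul]
    push_cast
    rfl
  have h2 : ∑ T ∈ A.powerset, ρ (swapOn T ⁻¹' E) =
      ∫⁻ f, (∑ T ∈ A.powerset, (swapOn T ⁻¹' E).indicator 1 f) ∂ρ := by
    rw [lintegral_finsetSum]
    · exact Finset.sum_congr rfl fun T _ =>
        (lintegral_indicator_one ((measurePreserving_swapOn μ T).measurable hEm)).symm
    · exact fun T _ => measurable_one.indicator ((measurePreserving_swapOn μ T).measurable hEm)
  have h3 : ∀ f, ∑ T ∈ A.powerset, (swapOn T ⁻¹' E).indicator (1 : (ι → ℝ × ℝ) → ENNReal) f ≤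
      2 ^ A.card * ENNReal.ofReal B := by
    intro f
    have h4 := card_exists_lt_abs_pairDiff_swapOn_le A f s hr
    rw [← hB] at h4
    have h5 : ∑ T ∈ A.powerset, (swapOn T ⁻¹' E).indicator (1 : (ι → ℝ × ℝ) → ENNReal) f =
        ((A.powerset.filter fun T => ∃ q : ℚ, s < |pairDiff A (swapOn T f) q|).card : ENNReal) := by
      rw [Finset.card_filter, Nat.cast_sum]
      refine Finset.sum_congr rfl fun T _ => ?_
      rw [Set.indicator_apply]
      simp [hE]
    rw [h5, ← ENNReal.ofReal_natCast]
    refine (ENNReal.ofReal_le_ofReal h4).trans (le_of_eq ?_)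
    rw [ENNReal.ofReal_mul (by positivity), ENNReal.ofReal_pow (by norm_num)]
    simp
  have h6 : (2 : ENNReal) ^ A.card * ρ E ≤ 2 ^ A.card * ENNReal.ofReal B := by
    rw [h1, h2]
    refine (lintegral_mono h3).trans ?_
    simp [lintegral_const]
  exact (ENNReal.mul_le_mul_iff_right (by simp) (by simp)).1 h6

/-! ### A uniform deviation inequality for independent variables -/

theorem measurable_ite_le_one_zero (q : ℝ) : Measurable fun x : ℝ => if x ≤ q then (1 : ℝ) else 0 :=
  Measurable.ite measurableSet_Iic measurable_const measurable_const

theorem measurable_deviation {ι : Type*} (A : Finset ι) (μ : ι → Measure ℝ) (q : ℝ) :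
    Measurable fun x : ι → ℝ => deviation A x μ q :=
  Finset.measurable_sum _ fun i _ =>
    ((measurable_ite_le_one_zero q).comp (measurable_pi_apply i)).sub_const _

/-- Chebyshev's inequality at a fixed point. -/
theorem measure_half_lt_abs_deviation_le {ι : Type*} [Fintype ι] (μ : ι → Measure ℝ)
    [∀ i, IsProbabilityMeasure (μ i)] (A : Finset ι) {t : ℝ} (ht : 0 < t)
    (htA : 2 * (A.card : ℝ) ≤ t ^ 2) (q : ℝ) :
    Measure.pi μ {x | t / 2 < |deviation A x μ q|} ≤ 1 / 2 := by
  let Y : (i : ι) → ℝ → ℝ := fun i y => (if y ≤ q then 1 else 0) - (μ i).real (Set.Iic q)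
  have hYm : ∀ i, Measurable (Y i) := fun i => (measurable_ite_le_one_zero q).sub_const _
  have hYb : ∀ i y, Y i y ∈ Set.Icc (-(μ i).real (Set.Iic q)) (1 - (μ i).real (Set.Iic q)) := by
    intro i y
    simp only [Y]
    split_ifs <;> constructor <;> linarith
  have hYL : ∀ i, MemLp (Y i) 2 (μ i) := fun i =>
    memLp_of_bounded (ae_of_all _ (hYb i)) (hYm i).aestronglyMeasurable 2
  let X : ι → (ι → ℝ) → ℝ := fun i x => Y i (x i)
  have hXL : ∀ i, MemLp (X i) 2 (Measure.pi μ) := fun i =>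
    (hYL i).comp_measurePreserving (measurePreserving_eval μ i)
  have hX0 : ∀ i, ∫ x, X i x ∂(Measure.pi μ) = 0 := by
    intro i
    have h1 : ∫ x, X i x ∂(Measure.pi μ) = ∫ y, Y i y ∂(μ i) := by
      rw [← (measurePreserving_eval μ i).map_eq, integral_map
        (measurable_pi_apply i).aemeasurable (hYm i).aestronglyMeasurable]
    rw [h1]
    have h2 : (fun y : ℝ => if y ≤ q then (1 : ℝ) else 0) = (Set.Iic q).indicator 1 := by
      funext y
      simp [Set.indicator_apply]
    simp only [Y]
    rw [integral_sub, h2, integral_indicator_one measurableSet_Iic]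
    · simp
    · rw [h2]
      exact (integrable_const (1 : ℝ)).indicator measurableSet_Iic
    · exact integrable_const _
  have hXi : iIndepFun X (Measure.pi μ) := iIndepFun_pi fun i => (hYm i).aemeasurable
  have hvar : ∀ i, variance (X i) (Measure.pi μ) ≤ 1 / 4 := by
    intro i
    have h := variance_le_sq_of_bounded (μ := Measure.pi μ) (X := X i)
      (ae_of_all _ fun x => hYb i (x i)) (hXL i).aestronglyMeasurable.aemeasurable
    refine h.trans (le_of_eq ?_)
    ring
  have hS : ∀ x, (∑ i ∈ A, X i) x = deviation A x μ q := fun x => by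
    rw [Finset.sum_apply]
    rfl
  have hSL : MemLp (∑ i ∈ A, X i) 2 (Measure.pi μ) := memLp_finsetSum' _ fun i _ => hXL i
  have hS0 : ∫ x, (∑ i ∈ A, X i) x ∂(Measure.pi μ) = 0 := by
    simp only [Finset.sum_apply]
    rw [integral_finsetSum _ fun i _ => (hXL i).integrable (by norm_num)]
    exact Finset.sum_eq_zero fun i _ => hX0 i
  have hSv : variance (∑ i ∈ A, X i) (Measure.pi μ) ≤ A.card * (1 / 4) := by
    rw [IndepFun.variance_sum (fun i _ => hXL i) fun i _ j _ hij => hXi.indepFun hij]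
    refine (Finset.sum_le_sum fun i _ => hvar i).trans (le_of_eq ?_)
    simp
  have h := meas_ge_le_variance_div_sq hSL (half_pos ht)
  rw [hS0] at h
  simp only [hS, sub_zero] at h
  have hsub : {x : ι → ℝ | t / 2 < |deviation A x μ q|} ⊆ {x | t / 2 ≤ |deviation A x μ q|} :=
    Set.ofPred_subset_ofPred.2 fun _ => le_of_lt
  refine (measure_mono hsub).trans (h.trans ?_)
  have h2 : variance (∑ i ∈ A, X i) (Measure.pi μ) / (t / 2) ^ 2 ≤ 1 / 2 := by
    rw [div_le_iff₀ (by positivity)]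
    nlinarith
  refine (ENNReal.ofReal_le_ofReal h2).trans (le_of_eq ?_)
  rw [ENNReal.ofReal_div_of_pos (by norm_num)]
  simp

theorem measurableSet_exists_lt_abs_deviation {ι : Type*} (A : Finset ι) (μ : ι → Measure ℝ)
    (t : ℝ) : MeasurableSet {x : ι → ℝ | ∃ q : ℚ, t < |deviation A x μ q|} := by
  rw [Set.ofPred_exists]
  exact MeasurableSet.iUnion fun q =>
    measurableSet_lt measurable_const (measurable_deviation A μ q).abs

/-- Symmetrization by an independent copy of the sample. -/
theorem measure_exists_lt_abs_deviation_le_pairDiff {ι : Type*} [Fintype ι] (μ : ι → Measure ℝ)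
    [∀ i, IsProbabilityMeasure (μ i)] (A : Finset ι) {t : ℝ} (ht : 0 < t)
    (htA : 2 * (A.card : ℝ) ≤ t ^ 2) :
    Measure.pi μ {x | ∃ q : ℚ, t < |deviation A x μ q|} ≤
      2 * (Measure.pi fun i => (μ i).prod (μ i)) {f | ∃ q : ℚ, t / 2 < |pairDiff A f q|} := by
  set E := {f : ι → ℝ × ℝ | ∃ q : ℚ, t / 2 < |pairDiff A f q|} with hE
  set B := {x : ι → ℝ | ∃ q : ℚ, t < |deviation A x μ q|} with hB
  have hEm : MeasurableSet E := measurableSet_exists_lt_abs_pairDiff A _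
  have hBm : MeasurableSet B := measurableSet_exists_lt_abs_deviation A μ t
  have hmp := (measurePreserving_arrowProdEquivProdArrow ℝ ℝ ι μ μ).symm
  rw [← hmp.measure_preimage hEm.nullMeasurableSet,
    Measure.prod_apply (hmp.measurable hEm)]
  have hsec : ∀ x ∈ B, (1 / 2 : ENNReal) ≤ Measure.pi μ (Prod.mk x ⁻¹'
      ((MeasurableEquiv.arrowProdEquivProdArrow ℝ ℝ ι).symm ⁻¹' E)) := by
    rintro x ⟨q, hq⟩
    -- At the point `q` where `x` deviates, the copy stays small with probability at least `1 / 2`.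
    have h1 := measure_half_lt_abs_deviation_le μ A ht htA q
    have hm : MeasurableSet {x : ι → ℝ | t / 2 < |deviation A x μ q|} :=
      measurableSet_lt measurable_const (measurable_deviation A μ q).abs
    have h2 : (1 / 2 : ENNReal) ≤ Measure.pi μ {x : ι → ℝ | t / 2 < |deviation A x μ q|}ᶜ := by
      rw [measure_compl hm (measure_ne_top _ _), measure_univ]
      refine le_trans (le_of_eq ?_) (tsub_le_tsub_left h1 1)
      simp [ENNReal.one_sub_inv_two]
    refine h2.trans (measure_mono fun x' hx' => ?_)
    have hx'' : |deviation A x' μ q| ≤ t / 2 := not_lt.1 hx'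
    have h3 : pairDiff A ((MeasurableEquiv.arrowProdEquivProdArrow ℝ ℝ ι).symm (x, x')) q =
        deviation A x μ q - deviation A x' μ q := by
      rw [pairDiff, deviation, deviation, ← Finset.sum_sub_distrib]
      refine Finset.sum_congr rfl fun i _ => ?_
      change ((if x i ≤ q then (1 : ℝ) else 0) - (if x' i ≤ q then (1 : ℝ) else 0)) = _
      ring
    refine ⟨q, ?_⟩
    rw [h3]
    have := abs_sub_abs_le_abs_sub (deviation A x μ q) (deviation A x' μ q)
    linarith
  have h4 : (1 / 2 : ENNReal) * Measure.pi μ B ≤ ∫⁻ x, Measure.pi μ (Prod.mk x ⁻¹'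
      ((MeasurableEquiv.arrowProdEquivProdArrow ℝ ℝ ι).symm ⁻¹' E)) ∂(Measure.pi μ) := by
    rw [← setLIntegral_const]
    exact (setLIntegral_mono_ae' hBm (ae_of_all _ hsec)).trans (setLIntegral_le_lintegral _ _)
  calc Measure.pi μ B = 2 * ((1 / 2 : ENNReal) * Measure.pi μ B) := by
        rw [← mul_assoc, one_div, ENNReal.mul_inv_cancel (by simp) (by simp), one_mul]
    _ ≤ _ := by gcongr

/-- A Dvoretzky–Kiefer–Wolfowitz inequality for independent, not necessarily identically
distributed, variables. The prefactor does not depend on the sample size. -/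
theorem measure_exists_lt_abs_deviation_le {ι : Type*} [Fintype ι] (μ : ι → Measure ℝ)
    [∀ i, IsProbabilityMeasure (μ i)] (A : Finset ι) {t : ℝ} (ht : 0 ≤ t) :
    Measure.pi μ {x | ∃ q : ℚ, t < |deviation A x μ q|} ≤
      ENNReal.ofReal (8 * Real.exp (-(t ^ 2 / (32 * A.card)))) := by
  rcases lt_or_ge (t ^ 2) (2 * (A.card : ℝ)) with hlt | hge
  · -- The right-hand side is at least `1`.
    have hm : (0 : ℝ) < A.card := by nlinarith [sq_nonneg t]
    refine prob_le_one.trans ?_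
    rw [← ENNReal.ofReal_one]
    refine ENNReal.ofReal_le_ofReal ?_
    have h1 : t ^ 2 / (32 * A.card) ≤ 1 / 16 := by
      rw [div_le_iff₀ (by positivity)]
      linarith
    have := Real.add_one_le_exp (-(t ^ 2 / (32 * (A.card : ℝ))))
    linarith
  rcases Nat.eq_zero_or_pos A.card with h0 | hpos
  · refine prob_le_one.trans ?_
    rw [← ENNReal.ofReal_one]
    refine ENNReal.ofReal_le_ofReal ?_
    simp [h0]
  have hm : (0 : ℝ) < A.card := Nat.cast_pos.2 hpos
  have ht' : 0 < t := lt_of_le_of_ne ht fun h => by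
    rw [← h] at hge
    simp only [ne_eq, OfNat.ofNat_ne_zero, not_false_eq_true, zero_pow] at hge
    linarith
  have hr : 0 ≤ t / (4 * A.card) := by positivity
  refine (measure_exists_lt_abs_deviation_le_pairDiff μ A ht' hge).trans ?_
  refine (mul_le_mul_right (measure_exists_lt_abs_pairDiff_le μ A (t / 2) hr) 2).trans ?_
  rw [show (2 : ENNReal) = ENNReal.ofReal 2 by simp, ← ENNReal.ofReal_mul (by norm_num)]
  refine ENNReal.ofReal_le_ofReal ?_
  have h1 : Real.cosh (t / (4 * A.card)) ^ A.card ≤ Real.exp (t ^ 2 / (32 * A.card)) := by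
    refine (pow_le_pow_left₀ (Real.cosh_pos _).le (Real.cosh_le_exp_half_sq _) _).trans
      (le_of_eq ?_)
    rw [← Real.exp_nat_mul]
    congr 1
    field_simp
    norm_num
  have h2 : Real.exp (-(t / (4 * A.card) * (t / 2 / 2))) * Real.cosh (t / (4 * A.card)) ^ A.card ≤
      Real.exp (-(t ^ 2 / (32 * A.card))) := by
    refine (mul_le_mul_of_nonneg_left h1 (Real.exp_pos _).le).trans (le_of_eq ?_)
    rw [← Real.exp_add]
    congr 1
    field_simp
    norm_num
  linarith

/-- A right-continuous process that is small on the rationals is small on the reals. -/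
theorem abs_deviation_le_of_forall_rat {ι : Type*} {A : Finset ι} {x : ι → ℝ}
    {μ : ι → Measure ℝ} [∀ i, IsProbabilityMeasure (μ i)] {t : ℝ}
    (h : ∀ q : ℚ, |deviation A x μ q| ≤ t) (y : ℝ) : |deviation A x μ y| ≤ t := by
  have hcont : ContinuousWithinAt (fun q => deviation A x μ q) (Set.Ici y) y := by
    unfold deviation
    refine tendsto_finsetSum _ fun i _ => Tendsto.sub ?_ ?_
    · refine Tendsto.congr' ?_ tendsto_const_nhds
      rcases le_or_gt (x i) y with hx | hx
      · filter_upwards [self_mem_nhdsWithin] with z hz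
        rw [if_pos hx, if_pos (hx.trans hz)]
      · filter_upwards [mem_nhdsWithin_of_mem_nhds (Iio_mem_nhds hx)] with z hz
        rw [if_neg (not_le.2 hx), if_neg (not_le.2 hz)]
    · have h1 : (fun q => (μ i).real (Set.Iic q)) = cdf (μ i) :=
        funext fun q => (cdf_eq_real (μ i) q).symm
      rw [h1, ← cdf_eq_real]
      exact (cdf (μ i)).right_continuous y
  have hlim : Tendsto (fun q => |deviation A x μ q|) (nhdsWithin y (Set.Ioi y))
      (nhds |deviation A x μ y|) :=
    (hcont.mono Set.Ioi_subset_Ici_self).tendsto.abs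
  by_contra! hlt
  have hev := hlim.eventually (lt_mem_nhds hlt)
  rw [eventually_nhdsWithin_iff, Metric.eventually_nhds_iff] at hev
  obtain ⟨δ, hδ, hball⟩ := hev
  obtain ⟨q, hq1, hq2⟩ := exists_rat_btwn (lt_add_of_pos_right y hδ)
  have := hball (y := (q : ℝ)) (by rw [Real.dist_eq, abs_of_pos (by linarith)]; linarith) hq1
  linarith [h q]

/-! ### Disintegration of a product of joint laws -/

/-- Kernel giving independent responses with laws `κ (y i)`. -/
def piKernel {ι : Type*} [Fintype ι] (κ : Kernel ℝ ℝ) [IsMarkovKernel κ] :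
    Kernel (ι → ℝ) (ι → ℝ) where
  toFun y := Measure.pi fun i => κ (y i)
  measurable' := by
    refine Measurable.measure_of_isPiSystem_of_isProbabilityMeasure generateFrom_pi.symm
      isPiSystem_pi ?_
    rintro _ ⟨s, hs, rfl⟩
    simp only [Measure.pi_pi]
    exact Finset.measurable_prod _ fun i _ =>
      (κ.measurable_coe (hs i (Set.mem_univ i))).comp (measurable_pi_apply i)

instance {ι : Type*} [Fintype ι] (κ : Kernel ℝ ℝ) [IsMarkovKernel κ] :
    IsMarkovKernel (piKernel (ι := ι) κ) :=
  ⟨fun y => by change IsProbabilityMeasure (Measure.pi fun i => κ (y i)); infer_instance⟩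

theorem lintegral_pi_prod {ι : Type*} [Fintype ι] (ν : Measure ℝ) [IsProbabilityMeasure ν]
    (g : ι → ℝ → ENNReal) (hg : ∀ i, Measurable (g i)) :
    ∫⁻ y, ∏ i, g i (y i) ∂(Measure.pi fun _ : ι => ν) = ∏ i, ∫⁻ a, g i a ∂ν := by
  rw [lintegral_prod_eq_prod_lintegral_of_indepFun Finset.univ
    (fun i (y : ι → ℝ) => g i (y i))
    (iIndepFun_pi fun i => (hg i).aemeasurable) fun i => (hg i).comp (measurable_pi_apply i)]
  refine Finset.prod_congr rfl fun i _ => ?_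
  exact (measurePreserving_eval (fun _ : ι => ν) i).lintegral_comp (hg i)

/-- Independent pairs can be drawn by first drawing all the first entries. -/
theorem map_compProd_piKernel {ι : Type*} [Fintype ι] (ν : Measure ℝ) [IsProbabilityMeasure ν]
    (κ : Kernel ℝ ℝ) [IsMarkovKernel κ] :
    ((Measure.pi fun _ : ι => ν) ⊗ₘ piKernel κ).map (fun w i => (w.1 i, w.2 i)) =
      Measure.pi fun _ : ι => ν ⊗ₘ κ := by
  have hm : Measurable fun (w : (ι → ℝ) × (ι → ℝ)) (i : ι) => (w.1 i, w.2 i) := by fun_prop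
  refine (Measure.pi_eq fun s hs => ?_).symm
  rw [Measure.map_apply hm (MeasurableSet.univ_pi hs),
    Measure.compProd_apply (hm (MeasurableSet.univ_pi hs))]
  have h1 : ∀ y : ι → ℝ, piKernel κ y (Prod.mk y ⁻¹'
      ((fun (w : (ι → ℝ) × (ι → ℝ)) (i : ι) => (w.1 i, w.2 i)) ⁻¹' Set.univ.pi s)) =
      ∏ i, κ (y i) (Prod.mk (y i) ⁻¹' s i) := by
    intro y
    rw [← Measure.pi_pi]
    change Measure.pi (fun i => κ (y i)) _ = _
    congr 1
  simp only [h1]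
  rw [lintegral_pi_prod ν (fun i a => κ a (Prod.mk a ⁻¹' s i)) fun i =>
    Kernel.measurable_kernel_prodMk_left (hs i)]
  exact Finset.prod_congr rfl fun i _ => (Measure.compProd_apply (hs i)).symm

/-! ### Conditioning on the responses -/

theorem measurable_card_finset {Ω ι : Type*} [MeasurableSpace Ω] [Fintype ι] {A : Ω → Finset ι}
    (hA : ∀ i, MeasurableSet {y | i ∈ A y}) : Measurable fun y => ((A y).card : ℝ) := by
  classical
  have h : (fun y => ((A y).card : ℝ)) = fun y => ∑ i, if i ∈ A y then (1 : ℝ) else 0 := by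
    funext y
    rw [Finset.sum_ite_mem]
    simp
  rw [h]
  exact Finset.measurable_sum _ fun i _ => Measurable.ite (hA i) measurable_const measurable_const

theorem measurable_deviation_kernel {Ω ι : Type*} [MeasurableSpace Ω] [Fintype ι]
    {A : Ω → Finset ι} (hA : ∀ i, MeasurableSet {y | i ∈ A y}) {x y : ι → Ω → ℝ}
    (hx : ∀ i, Measurable (x i)) (hy : ∀ i, Measurable (y i)) (κ : Kernel ℝ ℝ) (q : ℝ) :
    Measurable fun w => deviation (A w) (fun i => x i w) (fun i => κ (y i w)) q := by
  classical
  have h : (fun w => deviation (A w) (fun i => x i w) (fun i => κ (y i w)) q) =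
      fun w => ∑ i, if i ∈ A w then
        ((if x i w ≤ q then (1 : ℝ) else 0) - (κ (y i w)).real (Set.Iic q)) else 0 := by
    funext w
    rw [Finset.sum_ite_mem, Finset.univ_inter]
    rfl
  rw [h]
  refine Finset.measurable_sum _ fun i _ => Measurable.ite (hA i) (Measurable.sub ?_ ?_)
    measurable_const
  · exact (measurable_ite_le_one_zero q).comp (hx i)
  · exact ((κ.measurable_coe measurableSet_Iic).comp (hy i)).ennreal_toReal

/-- The deviation inequality for a set of indices chosen from the responses: given the
responses, the covariates are independent with laws `κ (y i)`. -/
theorem measure_pi_compProd_deviation_le {ι : Type*} [Fintype ι] (ν : Measure ℝ)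
    [IsProbabilityMeasure ν] (κ : Kernel ℝ ℝ) [IsMarkovKernel κ] {E : Set (ι → ℝ)}
    (hE : MeasurableSet E) {A : (ι → ℝ) → Finset ι} (hA : ∀ i, MeasurableSet {y | i ∈ A y})
    {ε m : ℝ} (hε : 0 ≤ ε) (hm : ∀ y ∈ E, m ≤ (A y).card) :
    (Measure.pi fun _ : ι => ν ⊗ₘ κ) {w | (fun i => (w i).1) ∈ E ∧ ∃ q : ℚ,
      ε * (A fun i => (w i).1).card < |deviation (A fun i => (w i).1) (fun i => (w i).2)
        (fun i => κ (w i).1) q|} ≤ ENNReal.ofReal (8 * Real.exp (-(ε ^ 2 * m / 32))) := by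
  set B := {w : ι → ℝ × ℝ | (fun i => (w i).1) ∈ E ∧ ∃ q : ℚ,
      ε * (A fun i => (w i).1).card < |deviation (A fun i => (w i).1) (fun i => (w i).2)
        (fun i => κ (w i).1) q|} with hB
  have hfst : Measurable fun (w : ι → ℝ × ℝ) (i : ι) => (w i).1 := by fun_prop
  have hA' : ∀ i, MeasurableSet {w : ι → ℝ × ℝ | i ∈ A fun i => (w i).1} := fun i => hfst (hA i)
  have hBm : MeasurableSet B := by
    have h : B = (fun w i => (w i).1) ⁻¹' E ∩ ⋃ q : ℚ, {w | ε * (A fun i => (w i).1).card <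
        |deviation (A fun i => (w i).1) (fun i => (w i).2) (fun i => κ (w i).1) q|} := by
      ext w
      simp [hB]
    rw [h]
    refine (hfst hE).inter <| MeasurableSet.iUnion fun q => measurableSet_lt
      ((measurable_card_finset hA').const_mul ε) (Measurable.abs ?_)
    exact measurable_deviation_kernel hA' (x := fun i w => (w i).2) (y := fun i w => (w i).1)
      (by fun_prop) (by fun_prop) κ q
  have hpair : Measurable fun (w : (ι → ℝ) × (ι → ℝ)) (i : ι) => (w.1 i, w.2 i) := by fun_prop
  rw [← map_compProd_piKernel, Measure.map_apply hpair hBm, Measure.compProd_apply (hpair hBm)]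
  refine (lintegral_mono (g := fun _ => ENNReal.ofReal (8 * Real.exp (-(ε ^ 2 * m / 32))))
    fun y => ?_).trans (by simp)
  change Measure.pi (fun i => κ (y i)) {x | y ∈ E ∧ ∃ q : ℚ, ε * (A y).card <
    |deviation (A y) x (fun i => κ (y i)) q|} ≤ _
  by_cases hy : y ∈ E
  · simp only [hy, true_and]
    refine (measure_exists_lt_abs_deviation_le (fun i => κ (y i)) (A y)
      (mul_nonneg hε (Nat.cast_nonneg _))).trans (ENNReal.ofReal_le_ofReal ?_)
    have h1 : (ε * ((A y).card : ℝ)) ^ 2 / (32 * (A y).card) = ε ^ 2 * (A y).card / 32 := by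
      rcases eq_or_ne ((A y).card : ℝ) 0 with h0 | h0
      · simp [h0]
      · field_simp
    rw [h1]
    have h2 : ε ^ 2 * m / 32 ≤ ε ^ 2 * (A y).card / 32 := by
      have := mul_le_mul_of_nonneg_left (hm y hy) (sq_nonneg ε)
      linarith
    have := Real.exp_le_exp.2 (neg_le_neg h2)
    linarith
  · simp [hy]

/-! ### Slices of a distribution function close to a continuous one -/

theorem continuous_real_Iic (ν : Measure ℝ) [IsProbabilityMeasure ν] [NullSingletonClass ν] :
    Continuous fun y => ν.real (Set.Iic y) := by
  have h : (fun y => ν.real (Set.Iic y)) = cdf ν := funext fun y => (cdf_eq_real ν y).symm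
  rw [h, continuous_iff_continuousAt]
  intro x
  rw [(monotone_cdf ν).continuousAt_iff_leftLim_eq_rightLim, StieltjesFunction.rightLim_eq]
  have h1 := (cdf ν).measure_singleton x
  rw [measure_cdf, measure_singleton] at h1
  have h2 := (monotone_cdf ν).leftLim_le (le_refl x)
  exact le_antisymm h2 (by linarith [ENNReal.ofReal_eq_zero.1 h1.symm])

theorem monotone_real_Iic (ν : Measure ℝ) [IsProbabilityMeasure ν] :
    Monotone fun y => ν.real (Set.Iic y) := fun _ _ h => measureReal_mono (Set.Iic_subset_Iic.2 h)

theorem le_of_forall_gt_of_continuous {f : ℝ → ℝ} (hf : Continuous f) {a c : ℝ}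
    (h : ∀ y, a < y → c ≤ f y) : c ≤ f a :=
  ge_of_tendsto (hf.continuousAt.tendsto.mono_left nhdsWithin_le_nhds :
    Tendsto f (nhdsWithin a (Set.Ioi a)) (nhds (f a)))
    (eventually_of_mem self_mem_nhdsWithin fun y hy => h y hy)

theorem le_of_forall_lt_of_continuous {f : ℝ → ℝ} (hf : Continuous f) {a c : ℝ}
    (h : ∀ y, y < a → f y ≤ c) : f a ≤ c :=
  le_of_tendsto (hf.continuousAt.tendsto.mono_left nhdsWithin_le_nhds :
    Tendsto f (nhdsWithin a (Set.Iio a)) (nhds (f a)))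
    (eventually_of_mem self_mem_nhdsWithin fun y hy => h y hy)

/-- The left limits of the distribution function of `μ` are as close to that of `ν`, by
continuity of the latter. -/
theorem abs_real_Iio_sub_le {μ ν : Measure ℝ} [IsProbabilityMeasure μ] [IsProbabilityMeasure ν]
    [NullSingletonClass ν] {δ : ℝ} (h : ∀ y, |μ.real (Set.Iic y) - ν.real (Set.Iic y)| ≤ δ) (y : ℝ) :
    |μ.real (Set.Iio y) - ν.real (Set.Iic y)| ≤ δ := by
  rw [abs_le]
  constructor
  · have := le_of_forall_lt_of_continuous (a := y) (c := μ.real (Set.Iio y) + δ)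
      (continuous_real_Iic ν) fun z hz => by
        have h1 : μ.real (Set.Iic z) ≤ μ.real (Set.Iio y) :=
          measureReal_mono (Set.Iic_subset_Iio.2 hz)
        linarith [(abs_le.1 (h z)).1]
    linarith
  · have h1 : μ.real (Set.Iio y) ≤ μ.real (Set.Iic y) := measureReal_mono Set.Iio_subset_Iic_self
    linarith [(abs_le.1 (h y)).2]

/-- Neither monotonicity nor continuity of `F` is needed. -/
theorem abs_real_Iic_quantile_sub_le {ν : Measure ℝ} [IsProbabilityMeasure ν] [NullSingletonClass ν]
    {F : ℝ → ℝ} {δ τ : ℝ} (h : ∀ y, |F y - ν.real (Set.Iic y)| ≤ δ) (h0 : δ < τ)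
    (h1 : τ + δ < 1) : |ν.real (Set.Iic (quantile F τ)) - τ| ≤ δ := by
  have hmono := monotone_real_Iic ν
  have hne : {y : ℝ | τ ≤ F y}.Nonempty := by
    have ht := tendsto_cdf_atTop ν
    obtain ⟨y, hy⟩ := (ht.eventually (lt_mem_nhds h1)).exists
    rw [cdf_eq_real] at hy
    exact ⟨y, show τ ≤ F y by linarith [(abs_le.1 (h y)).1]⟩
  have hbd : BddBelow {y : ℝ | τ ≤ F y} := by
    have ht := tendsto_cdf_atBot ν
    obtain ⟨y, hy⟩ := (ht.eventually (gt_mem_nhds (sub_pos.2 h0))).exists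
    rw [cdf_eq_real] at hy
    refine ⟨y, fun z hz => ?_⟩
    by_contra! hlt
    have h2 : ν.real (Set.Iic z) ≤ ν.real (Set.Iic y) := hmono hlt.le
    have h3 : τ ≤ F z := hz
    linarith [(abs_le.1 (h z)).2]
  rw [abs_le]
  constructor
  · have := le_of_forall_gt_of_continuous (a := quantile F τ) (c := τ - δ)
      (continuous_real_Iic ν) fun y hy => by
        obtain ⟨z, hz, hzy⟩ := exists_lt_of_csInf_lt hne hy
        have h2 : ν.real (Set.Iic z) ≤ ν.real (Set.Iic y) := hmono hzy.le
        have h3 : τ ≤ F z := hz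
        linarith [(abs_le.1 (h z)).2]
    linarith
  · have := le_of_forall_lt_of_continuous (a := quantile F τ) (c := τ + δ)
      (continuous_real_Iic ν) fun y hy => by
        have h3 : ¬ τ ≤ F y := fun h3 => not_lt.2 (csInf_le hbd h3) hy
        linarith [(abs_le.1 (h y)).1]
    linarith

section Slice

variable {μ ν : Measure ℝ} [IsProbabilityMeasure μ] [IsProbabilityMeasure ν] [NullSingletonClass ν]
  {F : ℝ → ℝ} {δ : ℝ} {G : ℕ}

theorem abs_real_Iic_quantile_div_sub_le (hF : ∀ y, |F y - ν.real (Set.Iic y)| ≤ δ)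
    (hδ : δ < 1 / G) {l : ℕ} (hl0 : l ≠ 0) (hl : l < G) :
    |ν.real (Set.Iic (quantile F ((l : ℝ) / G))) - (l : ℝ) / G| ≤ δ := by
  have hG : (0 : ℝ) < G := Nat.cast_pos.2 (by omega)
  refine abs_real_Iic_quantile_sub_le hF (hδ.trans_le ?_) (?_)
  · gcongr
    exact_mod_cast Nat.one_le_iff_ne_zero.2 hl0
  · have h1 : ((l : ℝ) + 1) / G ≤ 1 := by
      rw [div_le_one hG]
      exact_mod_cast hl
    have h2 : ((l : ℝ) + 1) / G = (l : ℝ) / G + 1 / G := add_div _ _ _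
    linarith

theorem real_Iic_mem_of_mem_slice (hF : ∀ y, |F y - ν.real (Set.Iic y)| ≤ δ) (hδ0 : 0 ≤ δ)
    (hδ : δ < 1 / G) {l : Fin G} {y : ℝ} (hy : y ∈ slice F G l) :
    (l : ℝ) / G - δ ≤ ν.real (Set.Iic y) ∧ ν.real (Set.Iic y) ≤ ((l : ℝ) + 1) / G + δ := by
  obtain ⟨h1, h2⟩ := hy
  have hG : (0 : ℝ) < G := Nat.cast_pos.2 (by have := l.2; omega)
  constructor
  · rcases eq_or_ne (l : ℕ) 0 with h0 | h0
    · rw [h0]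
      have : (0 : ℝ) ≤ ν.real (Set.Iic y) := measureReal_nonneg
      simp
      linarith
    · rw [cut, if_neg h0, if_pos l.2, EReal.coe_le_coe_iff] at h1
      have h3 := monotone_real_Iic ν h1
      have h4 := abs_le.1 (abs_real_Iic_quantile_div_sub_le hF hδ h0 l.2)
      simp only at h3
      linarith
  · rcases lt_or_ge ((l : ℕ) + 1) G with hl | hl
    · rw [cut, if_neg (Nat.succ_ne_zero _), if_pos hl, EReal.coe_lt_coe_iff] at h2
      have h3 := monotone_real_Iic ν h2.le
      have h4 := abs_le.1 (abs_real_Iic_quantile_div_sub_le hF hδ (Nat.succ_ne_zero _) hl)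
      push_cast at h3 h4
      linarith
    · have h3 : ν.real (Set.Iic y) ≤ 1 := measureReal_le_one
      have h4 : (1 : ℝ) ≤ ((l : ℝ) + 1) / G := by
        rw [le_div_iff₀ hG, one_mul]
        exact_mod_cast hl
      linarith

theorem abs_real_lt_cut_sub_le (hμ : ∀ y, |μ.real (Set.Iic y) - ν.real (Set.Iic y)| ≤ δ)
    (hF : ∀ y, |F y - ν.real (Set.Iic y)| ≤ δ) (hδ0 : 0 ≤ δ) (hδ : δ < 1 / G) (hG : 0 < G) {l : ℕ}
    (hl : l ≤ G) : |μ.real {y : ℝ | (y : EReal) < cut F G l} - (l : ℝ) / G| ≤ 2 * δ := by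
  have hG' : (0 : ℝ) < G := Nat.cast_pos.2 hG
  rcases eq_or_ne l 0 with rfl | h0
  · simp [cut, hδ0]
  rcases hl.lt_or_eq with hl | rfl
  · have h1 : {y : ℝ | (y : EReal) < cut F G l} = Set.Iio (quantile F ((l : ℝ) / G)) := by
      ext y
      simp [cut, h0, hl]
    rw [h1]
    have h2 := abs_real_Iio_sub_le hμ (quantile F ((l : ℝ) / G))
    have h3 := abs_real_Iic_quantile_div_sub_le hF hδ h0 hl
    have := abs_sub_le (μ.real (Set.Iio (quantile F ((l : ℝ) / G))))
      (ν.real (Set.Iic (quantile F ((l : ℝ) / G)))) ((l : ℝ) / G)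
    linarith
  · have h1 : {y : ℝ | (y : EReal) < cut F l l} = Set.univ := by
      ext y
      simp [cut, h0]
    rw [h1, div_self hG'.ne']
    simp [hδ0]

/-- Each slice of a distribution function close to that of `ν` has nearly the mass `1 / G`
under any law close to `ν`. -/
theorem le_real_slice (hμ : ∀ y, |μ.real (Set.Iic y) - ν.real (Set.Iic y)| ≤ δ)
    (hF : ∀ y, |F y - ν.real (Set.Iic y)| ≤ δ) (hδ0 : 0 ≤ δ) (hδ : δ < 1 / G) (l : Fin G) :
    1 / G - 4 * δ ≤ μ.real (slice F G l) := by
  have hG : 0 < G := by have := l.2; omega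
  have h1 := abs_le.1 (abs_real_lt_cut_sub_le hμ hF hδ0 hδ hG l.2.le)
  have h2 := abs_le.1 (abs_real_lt_cut_sub_le hμ hF hδ0 hδ hG (l := (l : ℕ) + 1) l.2)
  have h3 : {y : ℝ | (y : EReal) < cut F G ((l : ℕ) + 1)} ⊆
      {y : ℝ | (y : EReal) < cut F G l} ∪ slice F G l := by
    intro y hy
    rcases lt_or_ge (y : EReal) (cut F G l) with h | h
    · exact Or.inl h
    · exact Or.inr ⟨h, hy⟩
  have h4 := (measureReal_mono (μ := μ) h3).trans (measureReal_union_le _ _)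
  push_cast at h2
  have h5 : ((l : ℝ) + 1) / G = (l : ℝ) / G + 1 / G := add_div _ _ _
  linarith [h1.2, h2.1]

end Slice

theorem measurableSet_slice (F : ℝ → ℝ) (G : ℕ) (l : Fin G) : MeasurableSet (slice F G l) :=
  (measurableSet_le measurable_const measurable_coe_real_ereal).inter
    (measurableSet_lt measurable_coe_real_ereal measurable_const)

/-! ### Conditional distribution functions on a slice -/

theorem abs_kernel_sub_le_of_abs_real_Iic_sub_lt {ν : Measure ℝ} [IsProbabilityMeasure ν]
    [NullSingletonClass ν] {κ : Kernel ℝ ℝ} {c d : ℝ}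
    (h : ∀ b₁ b₂ : ℝ, ν.real (Set.Ico b₁ b₂) ≤ c →
      ∀ x : ℝ, ∀ y₁ ∈ Set.Ico b₁ b₂, ∀ y₂ ∈ Set.Ico b₁ b₂,
        |(κ y₁).real (Set.Iic x) - (κ y₂).real (Set.Iic x)| ≤ d)
    {y₁ y₂ : ℝ} (hy : |ν.real (Set.Iic y₁) - ν.real (Set.Iic y₂)| < c) (x : ℝ) :
    |(κ y₁).real (Set.Iic x) - (κ y₂).real (Set.Iic x)| ≤ d := by
  wlog hle : y₁ ≤ y₂ generalizing y₁ y₂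
  · rw [abs_sub_comm]
    exact this (by rwa [abs_sub_comm]) (le_of_not_ge hle)
  -- Continuity gives room for a half-open interval that contains `y₂`.
  have hlt : ν.real (Set.Iic y₂) < c + ν.real (Set.Iic y₁) := by linarith [(abs_lt.1 hy).1]
  obtain ⟨b, hb, hbc⟩ : ∃ b, y₂ < b ∧ ν.real (Set.Iic b) < c + ν.real (Set.Iic y₁) := by
    have h1 : ∀ᶠ b in nhdsWithin y₂ (Set.Ioi y₂),
        ν.real (Set.Iic b) < c + ν.real (Set.Iic y₁) :=
      ((continuous_real_Iic ν).continuousAt.tendsto.mono_left nhdsWithin_le_nhds).eventually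
        (gt_mem_nhds hlt)
    obtain ⟨b, hb1, hb2⟩ := (h1.and self_mem_nhdsWithin).exists
    exact ⟨b, hb2, hb1⟩
  refine h y₁ b ?_ x y₁ ⟨le_rfl, hle.trans_lt hb⟩ y₂ ⟨hle, hb⟩
  have h2 : ν.real (Set.Ico y₁ b) = ν.real (Set.Ioc y₁ b) :=
    measureReal_congr (Ico_ae_eq_Ioc (μ := ν))
  have h3 : ν.real (Set.Ioc y₁ b) = ν.real (Set.Iic b) - ν.real (Set.Iic y₁) := by
    rw [← Set.Iic_union_Ioc_eq_Iic (hle.trans hb.le),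
      measureReal_union (Set.Iic_disjoint_Ioc le_rfl) measurableSet_Ioc]
    ring
  linarith

/-- If the conditional distribution functions over `I` are all close to `v`, so is the
distribution function given `I`. -/
theorem abs_cond_real_sub_le {Ω : Type*} [MeasurableSpace Ω] {P : Measure Ω}
    [IsProbabilityMeasure P] {X Y : Ω → ℝ} (hX : Measurable X) (hY : Measurable Y)
    {κ : Kernel ℝ ℝ} [IsMarkovKernel κ]
    (hκ : P.map (fun w => (Y w, X w)) = (P.map Y) ⊗ₘ κ) {I : Set ℝ} (hI : MeasurableSet I)
    (hI0 : 0 < (P.map Y).real I) {x v d : ℝ}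
    (h : ∀ y ∈ I, |(κ y).real (Set.Iic x) - v| ≤ d) :
    |(cond P {w | Y w ∈ I}).real {w | X w ≤ x} - v| ≤ d := by
  have : IsProbabilityMeasure (P.map Y) := Measure.isProbabilityMeasure_map hY.aemeasurable
  set ν := P.map Y with hν
  have hνI : P.real {w | Y w ∈ I} = ν.real I := (map_measureReal_apply hY hI).symm
  have hκm : Measurable fun y => (κ y).real (Set.Iic x) :=
    (κ.measurable_coe measurableSet_Iic).ennreal_toReal
  have hint : Integrable (fun y => (κ y).real (Set.Iic x)) (ν.restrict I) :=
    Integrable.of_bound hκm.aestronglyMeasurable 1 (ae_of_all _ fun y => by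
      rw [Real.norm_of_nonneg measureReal_nonneg]
      exact measureReal_le_one)
  have hjoint : P.real ({w | Y w ∈ I} ∩ {w | X w ≤ x}) =
      ∫ y in I, (κ y).real (Set.Iic x) ∂ν := by
    have h1 : P.real ({w | Y w ∈ I} ∩ {w | X w ≤ x}) =
        (P.map fun w => (Y w, X w)).real (I ×ˢ Set.Iic x) :=
      (map_measureReal_apply (hY.prodMk hX) (hI.prod measurableSet_Iic)).symm
    rw [h1, hκ, measureReal_def, Measure.compProd_apply_prod hI measurableSet_Iic]
    rw [← integral_toReal (κ.measurable_coe measurableSet_Iic).aemeasurable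
      (ae_of_all _ fun y => measure_lt_top _ _)]
    rfl
  have hdiff : |P.real ({w | Y w ∈ I} ∩ {w | X w ≤ x}) - v * ν.real I| ≤ d * ν.real I := by
    have h1 : ∫ y in I, ((κ y).real (Set.Iic x) - v) ∂ν =
        P.real ({w | Y w ∈ I} ∩ {w | X w ≤ x}) - v * ν.real I := by
      rw [integral_sub hint (integrable_const _), hjoint, setIntegral_const, smul_eq_mul, mul_comm v]
    rw [← h1, ← Real.norm_eq_abs]
    exact norm_setIntegral_le_of_norm_le_const (measure_lt_top _ _) h
  have h2 : (cond P {w | Y w ∈ I}).real {w | X w ≤ x} - v =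
      (P.real ({w | Y w ∈ I} ∩ {w | X w ≤ x}) - v * ν.real I) / ν.real I := by
    rw [measureReal_def, cond_apply (s := {w | Y w ∈ I}) (hY hI), ENNReal.toReal_mul,
      ENNReal.toReal_inv, ← measureReal_def, ← measureReal_def, hνI]
    field_simp
  rw [h2, abs_div, abs_of_pos hI0, div_le_iff₀ hI0]
  exact hdiff

/-! ### The Kolmogorov statistic, the ranking and the gap -/

theorem maxKS_le_add {G : ℕ} (hG : 0 < G) {φ ψ : Fin G → ℝ → ℝ} {e : ℝ}
    (hψ : ∀ l x, ψ l x ∈ Set.Icc (0 : ℝ) 1) (h : ∀ l x, |φ l x - ψ l x| ≤ e) :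
    maxKS φ ≤ maxKS ψ + 2 * e := by
  have : Nonempty (Fin G) := ⟨⟨0, hG⟩⟩
  have hbdd : ∀ l m, BddAbove (Set.range fun x => |ψ l x - ψ m x|) := by
    intro l m
    refine ⟨1, ?_⟩
    rintro _ ⟨x, rfl⟩
    have h1 := hψ l x
    have h2 := hψ m x
    exact abs_le.2 ⟨by linarith [h1.1, h2.2], by linarith [h1.2, h2.1]⟩
  refine ciSup_le fun l => ciSup_le fun m => ciSup_le fun x => ?_
  have h1 : |ψ l x - ψ m x| ≤ maxKS ψ :=
    (le_ciSup (hbdd l m) x).trans <|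
      (le_ciSup (f := fun m => ⨆ x, |ψ l x - ψ m x|) (Set.finite_range _).bddAbove m).trans
        (le_ciSup (f := fun l => ⨆ m, ⨆ x, |ψ l x - ψ m x|) (Set.finite_range _).bddAbove l)
  have h2 := abs_le.1 (h l x)
  have h3 := abs_le.1 (h m x)
  have h4 := abs_le.1 h1
  exact abs_le.2 ⟨by linarith [h2.1, h3.2], by linarith [h2.2, h3.1]⟩

theorem abs_maxKS_sub_le {G : ℕ} (hG : 0 < G) {φ ψ : Fin G → ℝ → ℝ} {e : ℝ}
    (hφ : ∀ l x, φ l x ∈ Set.Icc (0 : ℝ) 1) (hψ : ∀ l x, ψ l x ∈ Set.Icc (0 : ℝ) 1)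
    (h : ∀ l x, |φ l x - ψ l x| ≤ e) : |maxKS φ - maxKS ψ| ≤ 2 * e := by
  have h1 := maxKS_le_add hG hψ h
  have h2 := maxKS_le_add hG hφ (e := e) (φ := ψ) fun l x => by rw [abs_sub_comm]; exact h l x
  exact abs_le.2 ⟨by linarith, by linarith⟩

theorem maxKS_eq_zero (φ : Fin 1 → ℝ → ℝ) : maxKS φ = 0 := by
  simp [maxKS, Fin.fin_one_eq_zero]

theorem subset_of_isTop {p d : ℕ} {v : Fin p → ℝ} {S T : Finset (Fin p)} (hS : S.card ≤ d)
    (hT : IsTop d v T) (h : ∀ j ∈ S, ∀ k ∉ S, v k < v j) : S ⊆ T := by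
  intro j hj
  by_contra hjT
  have h1 : T ⊆ S.erase j := by
    intro i hi
    refine Finset.mem_erase.2 ⟨fun h => hjT (h ▸ hi), ?_⟩
    by_contra hiS
    exact absurd (hT.2 i hi j hjT) (not_le.2 (h j hj i hiS))
  have h2 := Finset.card_le_card h1
  have h3 := Finset.card_pos.2 ⟨j, hj⟩
  have h4 : S.card ≤ p := by simpa using Finset.card_le_univ S
  rw [Finset.card_erase_of_mem hj, hT.1] at h2
  have := le_min hS h4
  omega

namespace Problem

variable {M : Problem}

theorem gap_add_oracleK_le (i : Fin M.N) {j k : Fin M.p} (hj : j ∈ M.S) (hk : k ∉ M.S) :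
    M.gap + oracleK M.P (M.G i) k ≤ oracleK M.P (M.G i) j := by
  have h1 : M.gap ≤ (⨅ j : {j : Fin M.p // j ∈ M.S}, oracleK M.P (M.G i) j) -
      ⨆ j : {j : Fin M.p // j ∉ M.S}, oracleK M.P (M.G i) j :=
    ciInf_le (Set.finite_range _).bddBelow i
  have h2 : (⨅ j : {j : Fin M.p // j ∈ M.S}, oracleK M.P (M.G i) j) ≤ oracleK M.P (M.G i) j :=
    ciInf_le (f := fun j : {j : Fin M.p // j ∈ M.S} => oracleK M.P (M.G i) j)
      (Set.finite_range _).bddBelow ⟨j, hj⟩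
  have h3 : oracleK M.P (M.G i) k ≤ ⨆ j : {j : Fin M.p // j ∉ M.S}, oracleK M.P (M.G i) j :=
    le_ciSup (f := fun j : {j : Fin M.p // j ∉ M.S} => oracleK M.P (M.G i) j)
      (Set.finite_range _).bddAbove ⟨k, hk⟩
  linarith

variable {n : ℕ}

/-- With a single slice the population statistics vanish, so a positive gap needs two. -/
theorem Assumptions.two_le_G (h : M.Assumptions n) (i : Fin M.N) : 2 ≤ M.G i := by
  by_contra! hlt
  have h1 : M.G i = 1 := le_antisymm (by omega) (h.G_pos i)
  have h2 : ∀ j, oracleK M.P (M.G i) j = 0 := by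
    intro j
    rw [h1]
    exact maxKS_eq_zero _
  have h3 : M.gap ≤ (⨅ j : {j : Fin M.p // j ∈ M.S}, oracleK M.P (M.G i) j) -
      ⨆ j : {j : Fin M.p // j ∉ M.S}, oracleK M.P (M.G i) j :=
    ciInf_le (Set.finite_range _).bddBelow i
  simp only [h2] at h3
  have h4 := h.c1.2
  simp at h3
  linarith

theorem Assumptions.one_lt_log (h : M.Assumptions n) : 1 < Real.log n := by
  have h1 := (h.two_le_G ⟨0, h.N_pos⟩).trans (h.G_le _)
  have h2 : 1 < ⌈Real.log n⌉₊ := h1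
  simpa using Nat.lt_ceil.1 h2

theorem Assumptions.n_pos (h : M.Assumptions n) : 0 < n := by
  rcases Nat.eq_zero_or_pos n with rfl | h0
  · have := h.one_lt_log
    simp at this
    linarith
  · exact h0

/-- Without covariates both extrema in the gap are `0`. -/
theorem Assumptions.p_pos (h : M.Assumptions n) : 0 < M.p := by
  rcases Nat.eq_zero_or_pos M.p with h0 | h0
  · have h1 : M.gap ≤ (⨅ j : {j : Fin M.p // j ∈ M.S}, oracleK M.P (M.G ⟨0, h.N_pos⟩) j) -
        ⨆ j : {j : Fin M.p // j ∉ M.S}, oracleK M.P (M.G ⟨0, h.N_pos⟩) j :=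
      ciInf_le (Set.finite_range _).bddBelow _
    have : IsEmpty (Fin M.p) := by rw [h0]; infer_instance
    simp only [Real.iInf_of_isEmpty, Real.iSup_of_isEmpty, sub_zero] at h1
    linarith [h.c1.2]
  · exact h0

theorem Assumptions.two_div_G_le (h : M.Assumptions n) (i : Fin M.N) :
    2 / (M.G i : ℝ) ≤ 2 / M.Gmin := by
  have : Nonempty (Fin M.N) := ⟨i⟩
  have h1 : 1 ≤ M.Gmin := le_ciInf h.G_pos
  have h2 : M.Gmin ≤ M.G i := ciInf_le (OrderBot.bddBelow _) i
  have h3 : (0 : ℝ) < M.Gmin := by exact_mod_cast h1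
  gcongr

end Problem

/-! ### Empirical slices -/

open Classical in
/-- Empirical distribution function of a real sample; for the responses of a sample `z`, this is
`empCDFY z` by definition. -/
def empDist {n : ℕ} (y : Fin n → ℝ) (t : ℝ) : ℝ :=
  ((Finset.univ.filter fun i => y i ≤ t).card : ℝ) / (n : ℝ)

open Classical in
/-- Indices of the observations with response in `A`. -/
def indexSet {n : ℕ} (y : Fin n → ℝ) (A : Set ℝ) : Finset (Fin n) :=
  Finset.univ.filter fun i => y i ∈ A

theorem mem_indexSet {n : ℕ} {y : Fin n → ℝ} {A : Set ℝ} {i : Fin n} :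
    i ∈ indexSet y A ↔ y i ∈ A := by
  simp [indexSet]

theorem map_uniformOn_real {n : ℕ} (y : Fin n → ℝ) {s : Set ℝ} (hs : MeasurableSet s) :
    ((uniformOn (Set.univ : Set (Fin n))).map y).real s = (indexSet y s).card / (n : ℝ) := by
  rw [map_measureReal_apply (measurable_of_finite y) hs, measureReal_def, uniformOn_univ]
  have h1 : y ⁻¹' s = ((indexSet y s : Finset (Fin n)) : Set (Fin n)) := by
    ext i
    simp [mem_indexSet]
  rw [h1, Measure.count_apply_finset, ENNReal.toReal_div]
  simp

theorem map_uniformOn_real_Iic {n : ℕ} (y : Fin n → ℝ) (t : ℝ) :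
    ((uniformOn (Set.univ : Set (Fin n))).map y).real (Set.Iic t) = empDist y t :=
  map_uniformOn_real y measurableSet_Iic

theorem deviation_univ {n : ℕ} (hn : 0 < n) (y : Fin n → ℝ) (ν : Measure ℝ) (t : ℝ) :
    deviation Finset.univ y (fun _ => ν) t = n * (empDist y t - ν.real (Set.Iic t)) := by
  classical
  have hn' : (n : ℝ) ≠ 0 := by positivity
  rw [deviation, Finset.sum_sub_distrib, Finset.sum_boole, empDist]
  simp only [Finset.sum_const, Finset.card_univ, Fintype.card_fin, nsmul_eq_mul]
  field_simp

/-- The samples whose empirical distribution function is within `δ` of that of `ν`, written with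
rational points to make measurability evident. -/
def nearSet (ν : Measure ℝ) (n : ℕ) (δ : ℝ) : Set (Fin n → ℝ) :=
  {y | ∃ q : ℚ, δ * n < |deviation Finset.univ y (fun _ => ν) q|}ᶜ

theorem measurableSet_nearSet (ν : Measure ℝ) (n : ℕ) (δ : ℝ) :
    MeasurableSet (nearSet ν n δ) :=
  (measurableSet_exists_lt_abs_deviation _ _ _).compl

theorem measure_compl_nearSet_le (ν : Measure ℝ) [IsProbabilityMeasure ν] {n : ℕ} (hn : 0 < n)
    {δ : ℝ} (hδ : 0 ≤ δ) : (Measure.pi fun _ : Fin n => ν) (nearSet ν n δ)ᶜ ≤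
      ENNReal.ofReal (8 * Real.exp (-(δ ^ 2 * n / 32))) := by
  rw [nearSet, compl_compl]
  refine (measure_exists_lt_abs_deviation_le (fun _ => ν) Finset.univ
    (by positivity)).trans (le_of_eq ?_)
  have hn' : (n : ℝ) ≠ 0 := by positivity
  rw [Finset.card_univ, Fintype.card_fin]
  congr 4
  field_simp

theorem abs_empDist_sub_le {ν : Measure ℝ} [IsProbabilityMeasure ν] {n : ℕ} (hn : 0 < n)
    {δ : ℝ} {y : Fin n → ℝ} (hy : y ∈ nearSet ν n δ) (t : ℝ) :
    |empDist y t - ν.real (Set.Iic t)| ≤ δ := by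
  have h1 : ∀ q : ℚ, |deviation Finset.univ y (fun _ => ν) q| ≤ δ * n := fun q =>
    not_lt.1 fun h => hy ⟨q, h⟩
  have h2 := abs_deviation_le_of_forall_rat h1 t
  have hn' : (0 : ℝ) < n := Nat.cast_pos.2 hn
  rw [deviation_univ hn, abs_mul, abs_of_pos hn', mul_comm] at h2
  exact le_of_mul_le_mul_right h2 hn'

theorem le_card_indexSet_slice {ν : Measure ℝ} [IsProbabilityMeasure ν] [NullSingletonClass ν]
    {n : ℕ} (hn : 0 < n) {δ : ℝ} (hδ0 : 0 ≤ δ) {y : Fin n → ℝ} (hy : y ∈ nearSet ν n δ)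
    {F : ℝ → ℝ} (hF : ∀ t, |F t - ν.real (Set.Iic t)| ≤ δ) {G : ℕ} (hδ : 8 * δ ≤ 1 / G)
    (l : Fin G) : (n : ℝ) / (2 * G) ≤ (indexSet y (slice F G l)).card := by
  have : Nonempty (Fin n) := ⟨⟨0, hn⟩⟩
  have hn' : (0 : ℝ) < n := Nat.cast_pos.2 hn
  have hG : (0 : ℝ) < G := Nat.cast_pos.2 (by have := l.2; omega)
  have hG' : (0 : ℝ) < 1 / G := by positivity
  have : IsProbabilityMeasure (uniformOn (Set.univ : Set (Fin n))) :=
    isProbabilityMeasure_uniformOn Set.finite_univ Set.univ_nonempty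
  have : IsProbabilityMeasure ((uniformOn (Set.univ : Set (Fin n))).map y) :=
    Measure.isProbabilityMeasure_map (measurable_of_finite y).aemeasurable
  have h1 := le_real_slice (μ := (uniformOn (Set.univ : Set (Fin n))).map y) (δ := δ)
    (fun t => by rw [map_uniformOn_real_Iic]; exact abs_empDist_sub_le hn hy t) hF hδ0
    (by linarith) l
  rw [map_uniformOn_real y (measurableSet_slice F G l), le_div_iff₀ hn'] at h1
  have h2 : (n : ℝ) / (2 * G) = 1 / G / 2 * n := by field_simp
  rw [h2]
  refine le_trans (mul_le_mul_of_nonneg_right ?_ hn'.le) h1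
  linarith

theorem measurable_empDist {n : ℕ} (t : ℝ) : Measurable fun y : Fin n → ℝ => empDist y t := by
  classical
  have h : (fun y : Fin n → ℝ => empDist y t) =
      fun y => (∑ i, if y i ≤ t then (1 : ℝ) else 0) / n := by
    funext y
    rw [Finset.sum_boole, empDist]
  rw [h]
  exact (Finset.measurable_sum _ fun i _ =>
    (measurable_ite_le_one_zero t).comp (measurable_pi_apply i)).div_const _

theorem monotone_empDist {n : ℕ} (y : Fin n → ℝ) : Monotone (empDist y) := by
  intro a b hab
  unfold empDist
  gcongr

/-- Galois connection between the sample quantile and the empirical distribution function. -/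
theorem quantile_empDist_le_iff {n : ℕ} (hn : 0 < n) (y : Fin n → ℝ) {τ : ℝ} (h0 : 0 < τ)
    (h1 : τ ≤ 1) (r : ℝ) : quantile (empDist y) τ ≤ r ↔ τ ≤ empDist y r := by
  classical
  have : Nonempty (Fin n) := ⟨⟨0, hn⟩⟩
  have hn' : (0 : ℝ) < n := Nat.cast_pos.2 hn
  have hbd : BddBelow {t : ℝ | τ ≤ empDist y t} := by
    obtain ⟨i, -, hi⟩ := Finset.exists_min_image Finset.univ y Finset.univ_nonempty
    refine ⟨y i, fun t ht => ?_⟩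
    by_contra! hlt
    have h2 : empDist y t = 0 := by
      rw [empDist, Finset.filter_eq_empty_iff.2 fun k _ =>
        not_le.2 (hlt.trans_le (hi k (Finset.mem_univ k)))]
      simp
    have h3 : τ ≤ empDist y t := ht
    linarith
  have hne : {t : ℝ | τ ≤ empDist y t}.Nonempty := by
    obtain ⟨i, -, hi⟩ := Finset.exists_max_image Finset.univ y Finset.univ_nonempty
    refine ⟨y i, ?_⟩
    have h2 : empDist y (y i) = 1 := by
      rw [empDist, Finset.filter_true_of_mem fun k hk => hi k hk]
      simp [hn'.ne']
    exact h1.trans h2.ge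
  refine ⟨fun h => ?_, fun h => csInf_le hbd h⟩
  -- The empirical distribution function is constant to the right of `r`.
  have hev : ∀ᶠ t in nhdsWithin r (Set.Ioi r), empDist y t = empDist y r := by
    have : ∀ᶠ t in nhdsWithin r (Set.Ioi r), ∀ i, (y i ≤ t ↔ y i ≤ r) := by
      refine eventually_all.2 fun i => ?_
      rcases le_or_gt (y i) r with hi | hi
      · filter_upwards [self_mem_nhdsWithin] with t ht
        exact ⟨fun _ => hi, fun _ => hi.trans (le_of_lt ht)⟩
      · filter_upwards [mem_nhdsWithin_of_mem_nhds (Iio_mem_nhds hi)] with t ht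
        exact ⟨fun h => absurd h (not_le.2 ht), fun h => absurd h (not_le.2 hi)⟩
    filter_upwards [this] with t ht
    simp only [empDist, ht]
  obtain ⟨t, ht1, ht2⟩ := (hev.and self_mem_nhdsWithin).exists
  obtain ⟨s, hs, hst⟩ := exists_lt_of_csInf_lt hne (h.trans_lt ht2)
  have h3 : τ ≤ empDist y s := hs
  exact h3.trans ((monotone_empDist y hst.le).trans ht1.le)

theorem measurable_cut_empDist {n : ℕ} (hn : 0 < n) (G l : ℕ) :
    Measurable fun y : Fin n → ℝ => cut (empDist y) G l := by
  unfold cut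
  split_ifs with h0 hl
  · exact measurable_const
  · refine measurable_coe_real_ereal.comp (measurable_of_Iic fun r => ?_)
    have hG : (0 : ℝ) < G := Nat.cast_pos.2 (by omega)
    have hτ0 : (0 : ℝ) < (l : ℝ) / G := div_pos (Nat.cast_pos.2 (by omega)) hG
    have hτ1 : (l : ℝ) / G ≤ 1 := by
      rw [div_le_one hG]
      exact_mod_cast hl.le
    have h1 : (fun y : Fin n → ℝ => quantile (empDist y) ((l : ℝ) / G)) ⁻¹' Set.Iic r =
        {y | (l : ℝ) / G ≤ empDist y r} := by
      ext y
      exact quantile_empDist_le_iff hn y hτ0 hτ1 r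
    rw [h1]
    exact measurableSet_le measurable_const (measurable_empDist r)
  · exact measurable_const

theorem measurableSet_mem_slice_empDist {n : ℕ} (hn : 0 < n) (G : ℕ) (l : Fin G) (k : Fin n) :
    MeasurableSet {y : Fin n → ℝ | y k ∈ slice (empDist y) G l} :=
  (measurableSet_le (measurable_cut_empDist hn G l)
    (measurable_coe_real_ereal.comp (measurable_pi_apply k))).inter
    (measurableSet_lt (measurable_coe_real_ereal.comp (measurable_pi_apply k))
      (measurable_cut_empDist hn G (l + 1)))

/-- From a small deviation over a set of indices to the proportions among them. -/
theorem abs_empCDF_sub_le {n p : ℕ} {z : Fin n → (Fin p → ℝ) × ℝ} {A : Set ℝ} {j : Fin p}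
    {x s ε d : ℝ} {κ : Kernel ℝ ℝ}
    (hpos : 0 < ((indexSet (fun i => (z i).2) A).card : ℝ))
    (hdev : |deviation (indexSet (fun i => (z i).2) A) (fun i => (z i).1 j)
      (fun i => κ (z i).2) x| ≤ ε * (indexSet (fun i => (z i).2) A).card)
    (hs : ∀ i, (z i).2 ∈ A → |s - (κ (z i).2).real (Set.Iic x)| ≤ d) :
    |empCDF z A j x - s| ≤ ε + d := by
  classical
  set I := indexSet (fun i => (z i).2) A with hI
  have h1 : empCDF z A j x = (∑ i ∈ I, if (z i).1 j ≤ x then (1 : ℝ) else 0) / I.card := by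
    rw [Finset.sum_boole, hI, indexSet, Finset.filter_filter, empCDF]
  have h2 : deviation I (fun i => (z i).1 j) (fun i => κ (z i).2) x =
      (∑ i ∈ I, if (z i).1 j ≤ x then (1 : ℝ) else 0) -
        ∑ i ∈ I, (κ (z i).2).real (Set.Iic x) := by
    rw [deviation, Finset.sum_sub_distrib]
  have h3 : |∑ i ∈ I, (κ (z i).2).real (Set.Iic x) - I.card * s| ≤ I.card * d := by
    have : ∑ i ∈ I, (κ (z i).2).real (Set.Iic x) - I.card * s =
        ∑ i ∈ I, ((κ (z i).2).real (Set.Iic x) - s) := by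
      rw [Finset.sum_sub_distrib]
      simp
    rw [this]
    refine (Finset.abs_sum_le_sum_abs _ _).trans ((Finset.sum_le_card_nsmul _ _ d
      fun i hi => ?_).trans (le_of_eq (nsmul_eq_mul _ _)))
    rw [abs_sub_comm]
    exact hs i (mem_indexSet.1 hi)
  rw [h2] at hdev
  have h4 : empCDF z A j x - s =
      ((∑ i ∈ I, if (z i).1 j ≤ x then (1 : ℝ) else 0) - I.card * s) / I.card := by
    rw [h1]
    field_simp
  rw [h4, abs_div, abs_of_pos hpos, div_le_iff₀ hpos]
  have h5 := abs_sub_le (∑ i ∈ I, if (z i).1 j ≤ x then (1 : ℝ) else 0)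
    (∑ i ∈ I, (κ (z i).2).real (Set.Iic x)) (I.card * s)
  linarith

theorem empCDF_mem_Icc {n p : ℕ} (z : Fin n → (Fin p → ℝ) × ℝ) (A : Set ℝ) (j : Fin p) (x : ℝ) :
    empCDF z A j x ∈ Set.Icc (0 : ℝ) 1 := by
  classical
  refine ⟨by unfold empCDF; positivity, ?_⟩
  refine div_le_one_of_le₀ ?_ (Nat.cast_nonneg _)
  exact Nat.cast_le.2 (Finset.card_le_card fun i hi => by
    simp only [Finset.mem_filter] at hi ⊢
    exact ⟨hi.1, hi.2.1⟩)

theorem sliceCDF_mem_Icc {p : ℕ} (P : Measure ((Fin p → ℝ) × ℝ)) [IsProbabilityMeasure P] (G : ℕ)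
    (j : Fin p) (l : Fin G) (x : ℝ) : sliceCDF P G j l x ∈ Set.Icc (0 : ℝ) 1 :=
  ⟨measureReal_nonneg, measureReal_le_one⟩

namespace Problem

variable (M : Problem)

instance : IsProbabilityMeasure M.P := M.isProb

/-- The law of the response. -/
def lawY : Measure ℝ := M.P.map fun w => w.2

instance : IsProbabilityMeasure M.lawY :=
  Measure.isProbabilityMeasure_map measurable_snd.aemeasurable

theorem cdfY_eq (y : ℝ) : cdfY M.P y = M.lawY.real (Set.Iic y) :=
  (map_measureReal_apply measurable_snd measurableSet_Iic).symm

variable {M} {n : ℕ}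

theorem Assumptions.nullSingletonClass (h : M.Assumptions n) : NullSingletonClass M.lawY :=
  ⟨fun y => by
    rw [lawY, Measure.map_apply measurable_snd (measurableSet_singleton y)]
    exact h.continuous_Y y⟩

/-- By the smoothness of the conditional laws, a response in a slice close to the `l`-th oracle
slice has a conditional distribution function close to that of the oracle slice. -/
theorem Assumptions.abs_sliceCDF_sub_le (h : M.Assumptions n) {j : Fin M.p} {κ : Kernel ℝ ℝ}
    [IsMarkovKernel κ] (hκ : M.P.map (fun w => (w.2, w.1 j)) = M.lawY ⊗ₘ κ)
    (hκ2 : ∀ b₁ b₂ : ℝ, M.P.real {w | w.2 ∈ Set.Ico b₁ b₂} ≤ 2 / (M.Gmin : ℝ) →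
      ∀ x : ℝ, ∀ y₁ ∈ Set.Ico b₁ b₂, ∀ y₂ ∈ Set.Ico b₁ b₂,
        |(κ y₁).real (Set.Iic x) - (κ y₂).real (Set.Iic x)| ≤ M.gap / 8)
    {i : Fin M.N} {F : ℝ → ℝ} {δ : ℝ} (hδ0 : 0 ≤ δ) (hδ : δ < 1 / M.G i)
    (hF : ∀ t, |F t - M.lawY.real (Set.Iic t)| ≤ δ) (l : Fin (M.G i)) {y : ℝ}
    (hy : y ∈ slice F (M.G i) l) (x : ℝ) :
    |sliceCDF M.P (M.G i) j l x - (κ y).real (Set.Iic x)| ≤ M.gap / 8 := by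
  have := h.nullSingletonClass
  have hF0 : ∀ t, |cdfY M.P t - M.lawY.real (Set.Iic t)| ≤ 0 := fun t => by
    rw [cdfY_eq, sub_self, abs_zero]
  have hpos : (0 : ℝ) < 1 / M.G i := hδ0.trans_lt hδ
  refine abs_cond_real_sub_le (X := fun w : (Fin M.p → ℝ) × ℝ => w.1 j)
    (Y := fun w : (Fin M.p → ℝ) × ℝ => w.2) (by fun_prop) (by fun_prop)
    hκ (measurableSet_slice (cdfY M.P) (M.G i) l) ?_ fun y' hy' => ?_
  · have := le_real_slice (μ := M.lawY) (ν := M.lawY) (δ := 0) (by simp) hF0 le_rfl hpos l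
    change 0 < M.lawY.real _
    linarith
  · refine abs_kernel_sub_le_of_abs_real_Iic_sub_lt (ν := M.lawY) (c := 2 / (M.Gmin : ℝ))
      (fun b₁ b₂ hb => hκ2 b₁ b₂ ?_) ?_ x
    · rwa [lawY, map_measureReal_apply measurable_snd measurableSet_Ico] at hb
    · refine lt_of_lt_of_le ?_ (h.two_div_G_le i)
      have h1 := real_Iic_mem_of_mem_slice hF hδ0 hδ hy
      have h2 := real_Iic_mem_of_mem_slice hF0 le_rfl hpos hy'
      have h3 : ((l : ℝ) + 1) / M.G i = (l : ℝ) / M.G i + 1 / M.G i := add_div _ _ _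
      have h4 : 2 / (M.G i : ℝ) = 1 / M.G i + 1 / M.G i := by ring
      rw [abs_lt]
      constructor <;> linarith [h1.1, h1.2, h2.1, h2.2]

/-- Uniformly small errors of the slice distribution functions give the right ranking. -/
theorem Assumptions.subset_of_isTop (h : M.Assumptions n) {F : ℝ → ℝ}
    {z : Fin n → (Fin M.p → ℝ) × ℝ}
    (hz : ∀ (i : Fin M.N) (j : Fin M.p) (l : Fin (M.G i)) (x : ℝ),
      |empCDF z (slice F (M.G i) l) j x - sliceCDF M.P (M.G i) j l x| ≤
        M.gap / 16 + M.gap / 8) {T : Finset (Fin M.p)}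
    (hT : IsTop M.d (fusedStat F M.G z) T) : M.D ⊆ T := by
  refine h.c1.1.trans (FusedKolmogorov.subset_of_isTop h.S_card_le hT fun j hj k hk => ?_)
  have : Nonempty (Fin M.N) := ⟨⟨0, h.N_pos⟩⟩
  have hgap := h.c1.2
  refine Finset.sum_lt_sum_of_nonempty Finset.univ_nonempty fun i _ => ?_
  have h1 : ∀ j, |maxKS (fun (l : Fin (M.G i)) x => empCDF z (slice F (M.G i) l) j x) -
      oracleK M.P (M.G i) j| ≤ 2 * (M.gap / 16 + M.gap / 8) := fun j =>
    abs_maxKS_sub_le (h.G_pos i) (fun l x => empCDF_mem_Icc _ _ _ _)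
      (fun l x => sliceCDF_mem_Icc M.P _ _ _ _) fun l x => hz i j l x
  have h2 := abs_le.1 (h1 j)
  have h3 := abs_le.1 (h1 k)
  have h4 := gap_add_oracleK_le i hj hk
  linarith [h2.1, h3.2]

end Problem

/-! ### The screening probabilities -/

namespace Problem

variable {M : Problem} {n : ℕ}

/-- Failure probability in one slice, before the union bound. -/
theorem measure_exists_lt_abs_deviation_sample_le {j : Fin M.p} {κ : Kernel ℝ ℝ}
    [IsMarkovKernel κ] (hκ : M.P.map (fun w => (w.2, w.1 j)) = M.lawY ⊗ₘ κ)
    {E : Set (Fin n → ℝ)} (hE : MeasurableSet E) {A : (Fin n → ℝ) → Finset (Fin n)}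
    (hA : ∀ i, MeasurableSet {y | i ∈ A y}) {ε m : ℝ} (hε : 0 ≤ ε)
    (hm : ∀ y ∈ E, m ≤ (A y).card) :
    (Measure.pi fun _ : Fin n => M.P) {z | (fun k => (z k).2) ∈ E ∧ ∃ q : ℚ,
      ε * (A fun k => (z k).2).card < |deviation (A fun k => (z k).2) (fun k => (z k).1 j)
        (fun k => κ (z k).2) q|} ≤ ENNReal.ofReal (8 * Real.exp (-(ε ^ 2 * m / 32))) := by
  have hf : Measurable fun w : (Fin M.p → ℝ) × ℝ => (w.2, w.1 j) := by fun_prop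
  have hmap : (Measure.pi fun _ : Fin n => M.P).map (fun z k => ((z k).2, (z k).1 j)) =
      Measure.pi fun _ : Fin n => M.lawY ⊗ₘ κ := by
    have : IsProbabilityMeasure (M.P.map fun w => (w.2, w.1 j)) :=
      Measure.isProbabilityMeasure_map hf.aemeasurable
    rw [← hκ]
    exact Measure.pi_map_pi (fun _ => hf.aemeasurable)
  have h1 := measure_pi_compProd_deviation_le M.lawY κ hE hA hε hm
  rw [← hmap] at h1
  exact (Measure.le_map_apply (by fun_prop) _).trans h1

/-- The screening probability for any slicing rule that is close to the true distribution
function whenever the empirical one is. -/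
theorem Assumptions.one_sub_le_real (h : M.Assumptions n) (F : (Fin n → ℝ) → ℝ → ℝ)
    (hFm : ∀ (G : ℕ) (l : Fin G) (k : Fin n), MeasurableSet {y | y k ∈ slice (F y) G l})
    (hF : ∀ δ : ℝ, 0 ≤ δ → ∀ y ∈ nearSet M.lawY n δ, ∀ t,
      |F y t - M.lawY.real (Set.Iic t)| ≤ δ) {L : ℝ} (hL : ∀ i, (M.G i : ℝ) ≤ L) :
    1 - (M.N * M.p * L * (8 * Real.exp (-(n * M.gap ^ 2 / (16384 * L)))) +
        8 * Real.exp (-(n / (2048 * L ^ 2)))) ≤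
      (Measure.pi fun _ : Fin n => M.P).real {z | ∀ T : Finset (Fin M.p),
        IsTop M.d (fusedStat (F fun k => (z k).2) M.G z) T → M.D ⊆ T} := by
  have hnull := h.nullSingletonClass
  have hn := h.n_pos
  have hgap := h.c1.2
  have hL1 : 1 ≤ L := le_trans (by exact_mod_cast h.G_pos ⟨0, h.N_pos⟩) (hL ⟨0, h.N_pos⟩)
  have hL0 : 0 < L := by linarith
  choose κ hκ1 hκ2 hκ3 using h.c2
  -- Small enough for slices to keep half of their mass `1 / G i ≥ 1 / L`.
  set δ : ℝ := 1 / (8 * L) with hδ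
  have hδ0 : 0 ≤ δ := by positivity
  have hG0 : ∀ i, (0 : ℝ) < M.G i := fun i => Nat.cast_pos.2 (h.G_pos i)
  have hδG : ∀ i, 8 * δ ≤ 1 / M.G i := by
    intro i
    have h1 : 8 * δ = 1 / L := by rw [hδ]; field_simp
    rw [h1]
    exact one_div_le_one_div_of_le (hG0 i) (hL i)
  have hδG' : ∀ i, δ < 1 / M.G i := fun i => by
    have h1 := hδG i
    have h2 : 0 < δ := by positivity
    linarith
  set E := nearSet M.lawY n δ with hE
  set ρ := Measure.pi fun _ : Fin n => M.P
  let A (i : Fin M.N) (l : Fin (M.G i)) (y : Fin n → ℝ) : Finset (Fin n) :=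
    indexSet y (slice (F y) (M.G i) l)
  have hAm : ∀ i l k, MeasurableSet {y | k ∈ A i l y} := by
    intro i l k
    simp only [A, mem_indexSet]
    exact hFm (M.G i) l k
  have hAcard : ∀ i l, ∀ y ∈ E, (n : ℝ) / (2 * L) ≤ (A i l y).card := by
    intro i l y hy
    refine le_trans ?_ (le_card_indexSet_slice hn hδ0 hy (hF δ hδ0 y hy) (hδG i) l)
    have := hL i
    have := hG0 i
    gcongr
  let B (i : Fin M.N) (j : Fin M.p) (l : Fin (M.G i)) : Set (Fin n → (Fin M.p → ℝ) × ℝ) :=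
    {z | (fun k => (z k).2) ∈ E ∧ ∃ q : ℚ, M.gap / 16 * (A i l fun k => (z k).2).card <
      |deviation (A i l fun k => (z k).2) (fun k => (z k).1 j) (fun k => κ j (z k).2) q|}
  set b := 8 * Real.exp (-(n * M.gap ^ 2 / (16384 * L))) with hb
  have hBle : ∀ i j l, ρ.real (B i j l) ≤ b := by
    intro i j l
    have := hκ1 j
    have h1 := measure_exists_lt_abs_deviation_sample_le (hκ2 j)
      (measurableSet_nearSet M.lawY n δ) (hAm i l) (ε := M.gap / 16) (by linarith) (hAcard i l)
    have h2 : (M.gap / 16) ^ 2 * (n / (2 * L)) / 32 = n * M.gap ^ 2 / (16384 * L) := by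
      field_simp
      norm_num
    rw [h2] at h1
    exact ENNReal.toReal_le_of_le_ofReal (by positivity) h1
  let E' : Set (Fin n → (Fin M.p → ℝ) × ℝ) := {z | (fun k => (z k).2) ∈ Eᶜ}
  have hE'le : ρ.real E' ≤ 8 * Real.exp (-(n / (2048 * L ^ 2))) := by
    have hmap : ρ.map (fun z k => (z k).2) = Measure.pi fun _ : Fin n => M.lawY :=
      haveI : IsProbabilityMeasure (M.P.map fun w => w.2) :=
        inferInstanceAs (IsProbabilityMeasure M.lawY)
      Measure.pi_map_pi (fun _ => measurable_snd.aemeasurable)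
    have hsnd : Measurable fun (z : Fin n → (Fin M.p → ℝ) × ℝ) k => (z k).2 := by fun_prop
    have h1 := measure_compl_nearSet_le M.lawY hn hδ0
    rw [← hmap] at h1
    have h2 : δ ^ 2 * n / 32 = n / (2048 * L ^ 2) := by
      rw [hδ]
      field_simp
      norm_num
    rw [h2] at h1
    exact ENNReal.toReal_le_of_le_ofReal (by positivity)
      ((Measure.le_map_apply hsnd.aemeasurable _).trans h1)
  set S := {z : Fin n → (Fin M.p → ℝ) × ℝ | ∀ T : Finset (Fin M.p),
    IsTop M.d (fusedStat (F fun k => (z k).2) M.G z) T → M.D ⊆ T} with hS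
  have hcover : Set.univ ⊆ S ∪ ((⋃ i, ⋃ j, ⋃ l, B i j l) ∪ E') := by
    intro z _
    by_cases hz1 : (fun k => (z k).2) ∈ E
    · by_cases hz2 : z ∈ ⋃ i, ⋃ j, ⋃ l, B i j l
      · exact Or.inr (Or.inl hz2)
      refine Or.inl fun T hT => h.subset_of_isTop (fun i j l x => ?_) hT
      have := hκ1 j
      refine abs_empCDF_sub_le (κ := κ j) ?_ ?_ fun k hk =>
        h.abs_sliceCDF_sub_le (hκ2 j) (hκ3 j) hδ0 (hδG' i) (hF δ hδ0 _ hz1) l hk x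
      · refine lt_of_lt_of_le ?_ (hAcard i l _ hz1)
        have : (0 : ℝ) < n := Nat.cast_pos.2 hn
        positivity
      · refine abs_deviation_le_of_forall_rat (fun q => ?_) x
        by_contra! hlt
        refine hz2 (Set.mem_iUnion.2 ⟨i, Set.mem_iUnion.2 ⟨j, Set.mem_iUnion.2 ⟨l, ?_⟩⟩⟩)
        exact ⟨hz1, q, hlt⟩
    · exact Or.inr (Or.inr hz1)
  have hU : ρ.real (⋃ i, ⋃ j, ⋃ l, B i j l) ≤ M.N * M.p * L * b := by
    have hb0 : 0 ≤ b := by positivity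
    refine (measureReal_iUnion_fintype_le _).trans ?_
    have h1 : ∀ i, ρ.real (⋃ j, ⋃ l, B i j l) ≤ M.p * L * b := by
      intro i
      refine (measureReal_iUnion_fintype_le _).trans ?_
      have h2 : ∀ j, ρ.real (⋃ l, B i j l) ≤ L * b := by
        intro j
        refine (measureReal_iUnion_fintype_le _).trans ?_
        refine (Finset.sum_le_sum fun l _ => hBle i j l).trans ?_
        simp only [Finset.sum_const, Finset.card_univ, Fintype.card_fin, nsmul_eq_mul]
        exact mul_le_mul_of_nonneg_right (hL i) hb0
      refine (Finset.sum_le_sum fun j _ => h2 j).trans (le_of_eq ?_)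
      simp [mul_assoc]
    refine (Finset.sum_le_sum fun i _ => h1 i).trans (le_of_eq ?_)
    simp [mul_assoc]
  have h1 : (1 : ℝ) ≤ ρ.real S + (ρ.real (⋃ i, ⋃ j, ⋃ l, B i j l) + ρ.real E') := by
    have h2 : ρ.real Set.univ ≤ _ := (measureReal_mono hcover).trans (measureReal_union_le _ _)
    rw [probReal_univ] at h2
    exact h2.trans (add_le_add le_rfl (measureReal_union_le _ _))
  linarith

/-- An error bound whose second term is free of the number `N` of slicings. -/
def sharpEta (M : Problem) (n : ℕ) : ℝ :=
  16 * M.N * M.p * Real.log n ^ 2 * Real.exp (-(1 / 32768 * (n * M.gap ^ 2 / Real.log n))) +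
    16 * Real.exp (-(1 / 32768 * (n / Real.log n ^ 2)))

theorem Assumptions.sharpEta_ge (h : M.Assumptions n) :
    M.N * M.p * (2 * Real.log n) *
      (8 * Real.exp (-(n * M.gap ^ 2 / (16384 * (2 * Real.log n))))) +
        8 * Real.exp (-(n / (2048 * (2 * Real.log n) ^ 2))) ≤ M.sharpEta n := by
  have hlog := h.one_lt_log
  set b := Real.log n
  have hb : 0 < b := by linarith
  unfold sharpEta
  refine add_le_add ?_ ?_
  · have h1 : n * M.gap ^ 2 / (16384 * (2 * b)) = 1 / 32768 * (n * M.gap ^ 2 / b) := by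
      field_simp
      ring
    rw [h1]
    have h2 : M.N * M.p * b ≤ M.N * M.p * b ^ 2 :=
      mul_le_mul_of_nonneg_left (by nlinarith) (by positivity)
    have h3 := mul_le_mul_of_nonneg_right h2
      (Real.exp_pos (-(1 / 32768 * (n * M.gap ^ 2 / b)))).le
    linarith
  · have h1 : 1 / 32768 * ((n : ℝ) / b ^ 2) ≤ n / (2048 * (2 * b) ^ 2) := by
      have h2 : (n : ℝ) / (2048 * (2 * b) ^ 2) = 1 / 8192 * (n / b ^ 2) := by
        field_simp
        ring
      rw [h2]
      have : 0 ≤ (n : ℝ) / b ^ 2 := by positivity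
      linarith
    have h2 := Real.exp_le_exp.2 (neg_le_neg h1)
    linarith [Real.exp_pos (-(1 / 32768 * ((n : ℝ) / b ^ 2)))]

theorem Assumptions.G_le_two_mul_log (h : M.Assumptions n) (i : Fin M.N) :
    (M.G i : ℝ) ≤ 2 * Real.log n := by
  have h1 : (M.G i : ℝ) ≤ ⌈Real.log n⌉₊ := Nat.cast_le.2 (h.G_le i)
  have h2 := Nat.ceil_lt_add_one (zero_le_one.trans h.one_lt_log.le)
  linarith [h.one_lt_log]

theorem Assumptions.one_sub_sharpEta_le_probOracle (h : M.Assumptions n) :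
    1 - M.sharpEta n ≤ M.probOracle n := by
  refine le_trans (by linarith [h.sharpEta_ge])
    (h.one_sub_le_real (fun _ => cdfY M.P) (fun G l k => ?_) (fun δ hδ y _ t => ?_)
      h.G_le_two_mul_log)
  · exact measurable_pi_apply k (measurableSet_slice _ G l)
  · rwa [cdfY_eq, sub_self, abs_zero]

theorem Assumptions.one_sub_sharpEta_le_probFilter (h : M.Assumptions n) :
    1 - M.sharpEta n ≤ M.probFilter n :=
  le_trans (by linarith [h.sharpEta_ge])
    (h.one_sub_le_real empDist (measurableSet_mem_slice_empDist h.n_pos)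
      (fun _ _ _ hy t => abs_empDist_sub_le h.n_pos hy t) h.G_le_two_mul_log)

theorem Assumptions.sharpEta_le_eta (h : M.Assumptions n) :
    M.sharpEta n ≤ M.eta 16 (1 / 32768) n := by
  have hlog := h.one_lt_log
  have hN : (1 : ℝ) ≤ M.N := by exact_mod_cast h.N_pos
  unfold sharpEta eta
  refine add_le_add le_rfl (mul_le_mul_of_nonneg_right ?_ (Real.exp_pos _).le)
  have h1 : (1 : ℝ) ≤ Real.log n ^ 2 := one_le_pow₀ hlog.le
  have h2 := one_le_mul_of_one_le_of_one_le hN h1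
  linarith

/-- Once the ratio of the gap to the critical rate is large, the first term is of order at most
`1 / log n`. The threshold `400` is chosen so that `400 ^ 2 / 32768 ≥ 3`. -/
theorem Assumptions.sharpEta_le (h : M.Assumptions n) (hr : 400 ≤ M.gap /
      Real.sqrt (Real.log n * Real.log ((M.p : ℝ) * M.N * Real.log n) / n)) :
    M.sharpEta n ≤ 16 / Real.log n + 16 * Real.exp (-(1 / 32768 * (n / Real.log n ^ 2))) := by
  have hlog := h.one_lt_log
  have hN : (1 : ℝ) ≤ M.N := by exact_mod_cast h.N_pos
  have hp : (1 : ℝ) ≤ M.p := by exact_mod_cast h.p_pos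
  have hn : (0 : ℝ) < n := Nat.cast_pos.2 h.n_pos
  have hpN : (1 : ℝ) ≤ M.p * M.N := one_le_mul_of_one_le_of_one_le hp hN
  set b := Real.log n
  set a := (M.p : ℝ) * M.N * b with ha
  have hba : b ≤ a := le_mul_of_one_le_left (by linarith) hpN
  have hb0 : 0 < b := by linarith
  have ha0 : 0 < a := by linarith
  have hla : 0 < Real.log a := Real.log_pos (by linarith)
  have harg : 0 < b * Real.log a / n := by positivity
  rw [le_div_iff₀ (Real.sqrt_pos.2 harg)] at hr
  have h1 : 400 ^ 2 * (b * Real.log a / n) ≤ M.gap ^ 2 := by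
    rw [← Real.sq_sqrt harg.le, ← mul_pow]
    exact pow_le_pow_left₀ (by positivity) hr 2
  have h2 : 3 * Real.log a ≤ 1 / 32768 * (n * M.gap ^ 2 / b) := by
    have h3 : 400 ^ 2 * Real.log a ≤ n * M.gap ^ 2 / b := by
      rw [le_div_iff₀ hb0]
      have := mul_le_mul_of_nonneg_left h1 hn.le
      have h4 : (n : ℝ) * (400 ^ 2 * (b * Real.log a / n)) = 400 ^ 2 * Real.log a * b := by
        field_simp
      linarith
    linarith
  have h3 : Real.exp (-(1 / 32768 * (n * M.gap ^ 2 / b))) ≤ (a ^ 3)⁻¹ := by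
    refine (Real.exp_le_exp.2 (neg_le_neg h2)).trans (le_of_eq ?_)
    rw [Real.exp_neg, mul_comm, Real.exp_mul, Real.exp_log ha0]
    norm_cast
  have h4 : M.N * M.p * b ^ 2 ≤ a ^ 2 := by
    rw [ha, mul_pow]
    refine mul_le_mul_of_nonneg_right ?_ (sq_nonneg b)
    nlinarith
  have h5 : M.N * M.p * b ^ 2 * Real.exp (-(1 / 32768 * (n * M.gap ^ 2 / b))) ≤ 1 / b := by
    refine (mul_le_mul h4 h3 (Real.exp_pos _).le (sq_nonneg a)).trans ?_
    have : a ^ 2 * (a ^ 3)⁻¹ = 1 / a := by field_simp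
    rw [this]
    exact one_div_le_one_div_of_le hb0 hba
  unfold sharpEta
  refine add_le_add ?_ le_rfl
  calc _ = 16 * (M.N * M.p * b ^ 2 * Real.exp (-(1 / 32768 * (n * M.gap ^ 2 / b)))) := by ring
    _ ≤ 16 * (1 / b) := by gcongr
    _ = 16 / b := by ring

theorem tendsto_sixteen_div_log_add :
    Tendsto (fun n : ℕ => 16 / Real.log n + 16 * Real.exp (-(1 / 32768 * (n / Real.log n ^ 2))))
      atTop (nhds 0) := by
  have hlog : Tendsto (fun n : ℕ => Real.log n) atTop atTop :=
    Real.tendsto_log_atTop.comp tendsto_natCast_atTop_atTop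
  have h1 : Tendsto (fun x : ℝ => x / Real.log x ^ 2) atTop atTop := by
    have h2 := Real.tendsto_pow_log_div_mul_add_atTop 1 0 2 one_ne_zero
    simp only [one_mul, add_zero] at h2
    have h3 : Tendsto (fun x : ℝ => Real.log x ^ 2 / x) atTop (nhdsWithin 0 (Set.Ioi 0)) := by
      refine tendsto_nhdsWithin_iff.2 ⟨h2, ?_⟩
      filter_upwards [eventually_gt_atTop 1] with x hx
      have := Real.log_pos hx
      have : 0 < x := by linarith
      exact Set.mem_Ioi.2 (by positivity)
    refine h3.inv_tendsto_nhdsGT_zero.congr fun x => ?_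
    simp
  have h2 := h1.comp tendsto_natCast_atTop_atTop (α := ℕ)
  have h3 := Real.tendsto_exp_neg_atTop_nhds_zero.comp
    (h2.const_mul_atTop (show (0 : ℝ) < 1 / 32768 by norm_num))
  have h4 := (hlog.const_div_atTop 16).add (h3.const_mul 16)
  simpa using h4

theorem tendsto_one_of_one_sub_sharpEta_le {M : ℕ → Problem} {f : ℕ → ℝ}
    (hM : ∀ᶠ n : ℕ in atTop, (M n).Assumptions n)
    (hr : Tendsto (fun n : ℕ => (M n).gap /
      Real.sqrt (Real.log n * Real.log (((M n).p : ℝ) * (M n).N * Real.log n) / n)) atTop atTop)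
    (hf : ∀ n, (M n).Assumptions n → 1 - (M n).sharpEta n ≤ f n) (hf1 : ∀ n, f n ≤ 1) :
    Tendsto f atTop (nhds 1) := by
  have h1 := (tendsto_const_nhds (x := (1 : ℝ))).sub tendsto_sixteen_div_log_add
  rw [sub_zero] at h1
  refine tendsto_of_tendsto_of_tendsto_of_le_of_le' h1 tendsto_const_nhds ?_
    (Eventually.of_forall hf1)
  filter_upwards [hM, hr.eventually_ge_atTop 400] with n hn hrn
  linarith [hf n hn, hn.sharpEta_le hrn]

end Problem

end FusedKolmogorov

end

theorem theorem1 :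
    (∃ C c : ℝ, 0 < C ∧ 0 < c ∧
      ∀ (n : ℕ) (M : FusedKolmogorov.Problem), M.Assumptions n →
        1 - M.eta C c n ≤ M.probOracle n ∧ 1 - M.eta C c n ≤ M.probFilter n) ∧
    (∀ M : ℕ → FusedKolmogorov.Problem,
      (∀ᶠ n : ℕ in atTop, (M n).Assumptions n) →
      Tendsto (fun n : ℕ => (M n).gap /
        Real.sqrt (Real.log n * Real.log (((M n).p : ℝ) * (M n).N * Real.log n) / n))
        atTop atTop →
      Tendsto (fun n : ℕ => (M n).probOracle n) atTop (nhds 1) ∧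
      Tendsto (fun n : ℕ => (M n).probFilter n) atTop (nhds 1)) := by
  refine ⟨⟨16, 1 / 32768, by norm_num, by norm_num, fun n M h => ⟨?_, ?_⟩⟩, fun M hM hr =>
    ⟨?_, ?_⟩⟩
  · linarith [h.sharpEta_le_eta, h.one_sub_sharpEta_le_probOracle]
  · linarith [h.sharpEta_le_eta, h.one_sub_sharpEta_le_probFilter]
  · exact FusedKolmogorov.Problem.tendsto_one_of_one_sub_sharpEta_le hM hr
      (fun n h => h.one_sub_sharpEta_le_probOracle) fun n => measureReal_le_one
  · exact FusedKolmogorov.Problem.tendsto_one_of_one_sub_sharpEta_le hM hr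
      (fun n h => h.one_sub_sharpEta_le_probFilter) fun n => measureReal_le_one
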